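/- Consider a networked dynamic system $\Sigma(\Phi)$ with $N$ subsystems, in continuous time ($\delta(x)=\dot x$) or discrete time ($\delta(x)(t)=x(t+1)$), $t\ge 0$: $$E(i)\,\delta(x(t,i))=A_{xx}(i)x(t,i)+B_{xv}(i)v(t,i)+B_{xu}(i)u(t,i),$$ $$z(t,i)=C_{zx}(i)x(t,i)+D_{zv}(i)v(t,i)+D_{zu}(i)u(t,i),\qquad y(t,i)=C_{yx}(i)x(t,i)+D_{yv}(i)v(t,i)+D_{yu}(i)u(t,i),$$ $i=1,\dots,N$, with real matrices, $E(i)$ square and possibly singular, coupled by $v(t)=\Phi z(t)$, where $v,z$ (and likewise $x,u,y$) are stacked from the subsystem vectors and $\Phi\in\mathbb R^{m_v\times m_z}$ is the subsystem connection matrix; let $m_z\ge 1$. For $\star\in\{z,y\}$, $\#\in\{u,v\}$ let $G_{\star\#}(\lambda,i)=D_{\star\#}(i)+C_{\star x}(i)(\lambda E(i)-A_{xx}(i))^{-1}B_{x\#}(i)$. A descriptor system $E\delta(x)=Ax+Bu$ is regular if $\det(\lambda E-A)\neq0$ for some $\lambda\in\mathbb C$; for $\Sigma(\Phi)$ this refers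 to its descriptor form with state $(x,z)$. A pair $(x(0),u)$ is admissible for $\Sigma(\Phi)$ if a trajectory with this initial state and external input exists. $\Phi$ and $\widetilde\Phi$ are differentiable if for every $x(0)$ that is admissible for both systems with some common external input, there is an external input $u$, admissible together with $x(0)$ for both systems, for which the external outputs $y(t,\Phi)$ and $y(t,\widetilde\Phi)$ are not identical on $t\ge0$. The structure is globally identifiable at $\Phi_0$ if $\Phi_0$ is differentiable from every $\Phi\in\mathbb R^{m_v\times m_z}$, $\Phi\ne\Phi_0$, for which $\Sigma(\Phi)$ is regular. Assume that $\Sigma(\Phi_0)$ and every subsystem are regular (A1), and that every $G_{zu}(\lambda,i)$ has full normal row rank, while at least one $G_{yv}(\lambda,j)$ does not have full normal column rank (A3). For each $i$, let $G_{yv}(\lambda,i)=U_{yv}(\lambda,i)\begin{bmatrix}\mathrm{diag}\{\kappa^{[j]}_{yv}(\lambda,i)\}_{j=1}^{r_i}&0\\0&0\end{bmatrix}V_{yv}^T(\lambda,i)$ be a Smith-McMillan form ($U_{yv},V_{yv}$ unimodular polynomial matrices, $\kappa^{[j]}_{yv}$ nonzero rational functions), and let $V_{yv}^{[iv,2]}(\lambda,i)$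 consist of the rows of $V_{yv}^{-1}(\lambda,i)$ after the first $r_i$. Let $G_{zv}(\lambda,i)=N_{zv}(\lambda,i)D_{zv}^{-1}(\lambda,i)$ be a right coprime polynomial matrix fraction description, and let $\widehat R,\widehat Q,\widehat\Omega$ be polynomial matrices with $$D_{zv}^{-1}(\lambda,i)V_{yv}^{[iv,2]T}(\lambda,i)=\widehat R(\lambda,i)+\widehat Q(\lambda,i)\widehat\Omega^{-1}(\lambda,i),$$ $\widehat Q,\widehat\Omega$ right coprime and $\widehat Q\widehat\Omega^{-1}$ strictly proper. Let $\widehat X(\lambda)$ and $\widehat Y(\lambda)$ be the block diagonal matrices with blocks $D_{zv}(\lambda,i)[\widehat R\widehat\Omega+\widehat Q](\lambda,i)$ and $N_{zv}(\lambda,i)[\widehat R\widehat\Omega+\widehat Q](\lambda,i)$, $i=1,\dots,N$. Let $$\widehat X(\lambda)-\Phi_0\widehat Y(\lambda)=\widehat U_{\Phi_0}(\lambda)\begin{bmatrix}\mathrm{diag}\{\widehat\mu^{[j]}_{\Phi_0}(\lambda)\}_{j=1}^{\widehat r}&0\\0&0\end{bmatrix}\widehat V_{\Phi_0}^T(\lambda)$$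 be a Smith form ($\widehat U_{\Phi_0},\widehat V_{\Phi_0}$ unimodular, $\widehat\mu^{[j]}_{\Phi_0}$ nonzero polynomials), let $\widehat U_{\Phi_0}^{[iv,2]}(\lambda)$ consist of the rows of $\widehat U_{\Phi_0}^{-1}(\lambda)$ after the first $\widehat r$, and write $\widehat U_{\Phi_0}^{[iv,2]}(\lambda)=\sum_{k=0}^{\widehat p}\lambda^k\widehat U_{\Phi_0,k}^{[iv,2]}$ with $\widehat p$ its degree. Then, for every such choice of factorizations, the structure is globally identifiable at $\Phi_0$ if and only if the real matrix $\widehat U_{\Phi_0}^{[iv,2]}=\mathrm{col}\{\widehat U_{\Phi_0,k}^{[iv,2]}\}_{k=0}^{\widehat p}$, which has $m_v$ columns, has full column rank. -/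

import Mathlib

open Polynomial
open scoped NNReal

noncomputable section

/-! ## Rational and polynomial matrices -/

/-- A real matrix as a constant rational matrix. -/
def constRat {ι κ : Type} (M : Matrix ι κ ℝ) : Matrix ι κ (RatFunc ℝ) :=
  M.map RatFunc.C

/-- A polynomial matrix as a rational matrix. -/
def polyRat {ι κ : Type} (M : Matrix ι κ ℝ[X]) : Matrix ι κ (RatFunc ℝ) :=
  M.map (algebraMap ℝ[X] (RatFunc ℝ))

/-- The transfer function matrix `D + C (λ E - A)⁻¹ B`. -/
def transferMatrix {n p q : Type} [Fintype n] [DecidableEq n]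
    (E A : Matrix n n ℝ) (B : Matrix n q ℝ) (C : Matrix p n ℝ) (D : Matrix p q ℝ) :
    Matrix p q (RatFunc ℝ) :=
  constRat D +
    constRat C * ((RatFunc.X : RatFunc ℝ) • constRat E - constRat A)⁻¹ * constRat B

/-- Regularity of the descriptor pencil: `det (λ E - A) ≠ 0` for some complex `λ`. -/
def IsRegularPencil {n : Type} [Fintype n] [DecidableEq n] (E A : Matrix n n ℝ) : Prop :=
  ∃ s : ℂ, (s • E.map (algebraMap ℝ ℂ) - A.map (algebraMap ℝ ℂ)).det ≠ 0

/-- Normal rank of a rational matrix: the maximal rank of its values at the complex points that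
are not poles of any entry. -/
def normalRank {ι κ : Type} [Fintype κ] (M : Matrix ι κ (RatFunc ℝ)) : ℕ :=
  sSup {r : ℕ | ∃ s : ℂ, (∀ i j, Polynomial.aeval s (M i j).denom ≠ 0) ∧
    r = (M.map (RatFunc.eval (algebraMap ℝ ℂ) s)).rank}

/-- Full normal row rank. -/
def IsFNRR {ι κ : Type} [Fintype ι] [Fintype κ] (M : Matrix ι κ (RatFunc ℝ)) : Prop :=
  normalRank M = Fintype.card ι

/-- Full normal column rank. -/
def IsFNCR {ι κ : Type} [Fintype κ] (M : Matrix ι κ (RatFunc ℝ)) : Prop :=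
  normalRank M = Fintype.card κ

/-- Full column rank of a real matrix. -/
def IsFCR {ι κ : Type} [Fintype κ] (M : Matrix ι κ ℝ) : Prop :=
  M.rank = Fintype.card κ

/-- Every entry is strictly proper. -/
def IsStrictlyProper {ι κ : Type} (M : Matrix ι κ (RatFunc ℝ)) : Prop :=
  ∀ i j, (M i j).num.degree < (M i j).denom.degree

/-- Right coprimeness of polynomial matrices: every common right divisor is unimodular. -/
def IsRightCoprime {ι κ : Type} [Fintype κ] [DecidableEq κ]
    (P : Matrix ι κ ℝ[X]) (Q : Matrix κ κ ℝ[X]) : Prop :=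
  ∀ (W : Matrix κ κ ℝ[X]) (P' : Matrix ι κ ℝ[X]) (Q' : Matrix κ κ ℝ[X]),
    P = P' * W → Q = Q' * W → IsUnit W

/-- The `m × n` matrix with the block `diag {d 0, …, d (r-1)}` in the upper left corner and zeros
elsewhere. -/
def rectDiag {R : Type} [Zero R] (m n : ℕ) {r : ℕ} (d : Fin r → R) :
    Matrix (Fin m) (Fin n) R :=
  Matrix.of fun a b => if h : (a : ℕ) < r then (if (b : ℕ) = a then d ⟨a, h⟩ else 0) else 0

/-- A Smith form (entries of `M` in `K = ℝ[X]`) or Smith-McMillan form (entries of `M` in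
`K = RatFunc ℝ`): `M = U * [diag d, 0; 0, 0] * Vᵀ` with unimodular polynomial matrices `U`, `V`,
whose polynomial inverses are recorded as `Uinv`, `Vinv`, and nonzero `d j`. Rows and columns of `M`
may be labelled by arbitrary finite types; the inner indices are ordered, so that "the first `r`
rows" of `Uinv` and `Vinv` makes sense. The usual divisibility chain and monic normalization of
the `d j` are not imposed; every normalized form is included. -/
structure SmithForm {ι κ K : Type} [Fintype ι] [DecidableEq ι] [Fintype κ] [DecidableEq κ]
    [CommRing K] [Algebra ℝ[X] K] (m n : ℕ) (M : Matrix ι κ K) where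
  r : ℕ
  r_le_m : r ≤ m
  r_le_n : r ≤ n
  U : Matrix ι (Fin m) ℝ[X]
  Uinv : Matrix (Fin m) ι ℝ[X]
  V : Matrix κ (Fin n) ℝ[X]
  Vinv : Matrix (Fin n) κ ℝ[X]
  U_mul_Uinv : U * Uinv = 1
  Uinv_mul_U : Uinv * U = 1
  V_mul_Vinv : V * Vinv = 1
  Vinv_mul_V : Vinv * V = 1
  d : Fin r → K
  d_ne_zero : ∀ j, d j ≠ 0
  eq_mul : M = U.map (algebraMap ℝ[X] K) * rectDiag m n d * (V.map (algebraMap ℝ[X] K)).transpose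

namespace SmithForm

variable {ι κ K : Type} [Fintype ι] [DecidableEq ι] [Fintype κ] [DecidableEq κ]
  [CommRing K] [Algebra ℝ[X] K] {m n : ℕ} {M : Matrix ι κ K}

/-- The rows of `U⁻¹` after the first `r` ones. -/
def Uinv2 (S : SmithForm m n M) : Matrix {k : Fin m // S.r ≤ (k : ℕ)} ι ℝ[X] :=
  S.Uinv.submatrix Subtype.val id

/-- The rows of `V⁻¹` after the first `r` ones. -/
def Vinv2 (S : SmithForm m n M) : Matrix {k : Fin n // S.r ≤ (k : ℕ)} κ ℝ[X] :=
  S.Vinv.submatrix Subtype.val id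

end SmithForm

/-- The degree of a polynomial matrix: the maximal degree of its entries. -/
def matDegree {ι κ : Type} [Fintype ι] [Fintype κ] (P : Matrix ι κ ℝ[X]) : ℕ :=
  Finset.univ.sup fun i => Finset.univ.sup fun j => (P i j).natDegree

/-- The coefficient matrices `P_0, …, P_p` of `P = ∑ λ^k P_k`, `p` the degree of `P`, stacked on
top of each other. -/
def stackedCoeffs {ι κ : Type} [Fintype ι] [Fintype κ] (P : Matrix ι κ ℝ[X]) :
    Matrix (Fin (matDegree P + 1) × ι) κ ℝ :=
  Matrix.of fun a j => (P a.2 j).coeff a.1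

/-! ## Time -/

/-- Continuous or discrete time. -/
inductive TimeKind
  | continuous
  | discrete

/-- The time axis, starting at `0`. -/
def TimeKind.Time : TimeKind → Type
  | .continuous => ℝ≥0
  | .discrete => ℕ

/-- The initial time. -/
def TimeKind.start : (τ : TimeKind) → τ.Time
  | .continuous => (0 : ℝ≥0)
  | .discrete => (0 : ℕ)

/-- `dx = δ(x)`: the derivative with respect to time (one-sided at time `0`), or the forward
shift. -/
def TimeKind.IsDelta {n : Type} [Fintype n] :
    (τ : TimeKind) → (τ.Time → n → ℝ) → (τ.Time → n → ℝ) → Prop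
  | .continuous => fun (x dx : ℝ≥0 → n → ℝ) =>
      ∀ t : ℝ≥0, HasDerivWithinAt (fun s : ℝ => x s.toNNReal) (dx t) (Set.Ici 0) (t : ℝ)
  | .discrete => fun (x dx : ℕ → n → ℝ) => ∀ t : ℕ, dx t = x (t + 1)

/-! ## Networked dynamic systems -/

/-- The subsystem data of a networked dynamic system with `N` descriptor form subsystems. -/
structure NDS (N : ℕ) where
  mx : Fin N → ℕ
  mu : Fin N → ℕ
  mv : Fin N → ℕ
  my : Fin N → ℕ
  mz : Fin N → ℕ
  E : (i : Fin N) → Matrix (Fin (mx i)) (Fin (mx i)) ℝ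
  Axx : (i : Fin N) → Matrix (Fin (mx i)) (Fin (mx i)) ℝ
  Bxv : (i : Fin N) → Matrix (Fin (mx i)) (Fin (mv i)) ℝ
  Bxu : (i : Fin N) → Matrix (Fin (mx i)) (Fin (mu i)) ℝ
  Czx : (i : Fin N) → Matrix (Fin (mz i)) (Fin (mx i)) ℝ
  Dzv : (i : Fin N) → Matrix (Fin (mz i)) (Fin (mv i)) ℝ
  Dzu : (i : Fin N) → Matrix (Fin (mz i)) (Fin (mu i)) ℝ
  Cyx : (i : Fin N) → Matrix (Fin (my i)) (Fin (mx i)) ℝ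
  Dyv : (i : Fin N) → Matrix (Fin (my i)) (Fin (mv i)) ℝ
  Dyu : (i : Fin N) → Matrix (Fin (my i)) (Fin (mu i)) ℝ

/-- Index type of a vector stacked from subsystem vectors of dimensions `m i`. -/
abbrev Stack {N : ℕ} (m : Fin N → ℕ) : Type := Σ i : Fin N, Fin (m i)

/-- The block of a stacked vector that belongs to subsystem `i`. -/
def block {N : ℕ} {m : Fin N → ℕ} (w : Stack m → ℝ) (i : Fin N) : Fin (m i) → ℝ :=
  fun j => w ⟨i, j⟩

namespace NDS

variable {N : ℕ} (S : NDS N)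

/-- Subsystem connection matrices: real `m_v × m_z` matrices. -/
abbrev SCM : Type := Matrix (Stack S.mv) (Stack S.mz) ℝ

/-- Subsystem `i` is regular. -/
def SubsystemRegular (i : Fin N) : Prop := IsRegularPencil (S.E i) (S.Axx i)

/-- The whole system with connection matrix `Φ`, as a descriptor system with state
`(x, z)`, is regular. -/
def NetworkRegular (Φ : S.SCM) : Prop :=
  IsRegularPencil
    (Matrix.fromBlocks (Matrix.blockDiagonal' S.E) 0 0 (0 : Matrix (Stack S.mz) (Stack S.mz) ℝ))
    (Matrix.fromBlocks (Matrix.blockDiagonal' S.Axx) (Matrix.blockDiagonal' S.Bxv * Φ)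
      (Matrix.blockDiagonal' S.Czx) (Matrix.blockDiagonal' S.Dzv * Φ - 1))

/-- `y` is an external output of the system with connection matrix `Φ` for the initial state `x₀`
and the external input `u`: some trajectory with `x(0) = x₀` satisfies the subsystem equations
and `v = Φ z`. In particular `x₀` and `u` are admissible exactly when such a `y` exists. -/
def IsOutput (τ : TimeKind) (Φ : S.SCM) (x₀ : Stack S.mx → ℝ)
    (u : τ.Time → Stack S.mu → ℝ) (y : τ.Time → Stack S.my → ℝ) : Prop :=
  ∃ (x dx : τ.Time → Stack S.mx → ℝ) (v : τ.Time → Stack S.mv → ℝ)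
    (z : τ.Time → Stack S.mz → ℝ),
    x τ.start = x₀ ∧ τ.IsDelta x dx ∧
    (∀ t, v t = Φ.mulVec (z t)) ∧
    ∀ t i,
      (S.E i).mulVec (block (dx t) i) =
        (S.Axx i).mulVec (block (x t) i) + (S.Bxv i).mulVec (block (v t) i) +
          (S.Bxu i).mulVec (block (u t) i) ∧
      block (z t) i =
        (S.Czx i).mulVec (block (x t) i) + (S.Dzv i).mulVec (block (v t) i) +
          (S.Dzu i).mulVec (block (u t) i) ∧
      block (y t) i =
        (S.Cyx i).mulVec (block (x t) i) + (S.Dyv i).mulVec (block (v t) i) +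
          (S.Dyu i).mulVec (block (u t) i)

/-- The initial state `x₀` and the input `u` are admissible for the system with matrix `Φ`. -/
def Admissible (τ : TimeKind) (Φ : S.SCM) (x₀ : Stack S.mx → ℝ)
    (u : τ.Time → Stack S.mu → ℝ) : Prop :=
  ∃ y, S.IsOutput τ Φ x₀ u y

/-- `Φ` and `Φ'` are differentiable from each other: for every initial state that is admissible (for
the two systems, driven by a common input), some input that is admissible with it for both
systems produces different external outputs. -/
def DifferentiableSCM (τ : TimeKind) (Φ Φ' : S.SCM) : Prop :=
  ∀ x₀ : Stack S.mx → ℝ,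
    (∃ u, S.Admissible τ Φ x₀ u ∧ S.Admissible τ Φ' x₀ u) →
    ∃ u y y', S.IsOutput τ Φ x₀ u y ∧ S.IsOutput τ Φ' x₀ u y' ∧ y ≠ y'

/-- Global identifiability of the structure at `Φ₀`, when no a priori information on the
connections is available: `Φ₀` is differentiable from every other connection matrix
that gives a regular system. -/
def GloballyIdentifiableAt (τ : TimeKind) (Φ₀ : S.SCM) : Prop :=
  ∀ Φ : S.SCM, S.NetworkRegular Φ → Φ ≠ Φ₀ → S.DifferentiableSCM τ Φ₀ Φ

/-- `G_zu(λ, i)`. -/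
def Gzu (i : Fin N) : Matrix (Fin (S.mz i)) (Fin (S.mu i)) (RatFunc ℝ) :=
  transferMatrix (S.E i) (S.Axx i) (S.Bxu i) (S.Czx i) (S.Dzu i)

/-- `G_zv(λ, i)`. -/
def Gzv (i : Fin N) : Matrix (Fin (S.mz i)) (Fin (S.mv i)) (RatFunc ℝ) :=
  transferMatrix (S.E i) (S.Axx i) (S.Bxv i) (S.Czx i) (S.Dzv i)

/-- `G_yv(λ, i)`. -/
def Gyv (i : Fin N) : Matrix (Fin (S.my i)) (Fin (S.mv i)) (RatFunc ℝ) :=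
  transferMatrix (S.E i) (S.Axx i) (S.Bxv i) (S.Cyx i) (S.Dyv i)

/-- A choice, for every subsystem, of a Smith-McMillan form of `G_yv`, of a right coprime matrix
fraction description `G_zv = Nzv * Dzv⁻¹` (here `NN`, `DD`), and of polynomial matrices with
`Dzv⁻¹ * Vinv2ᵀ = R + Q * Ω⁻¹`, where `Q`, `Ω` are right coprime and `Q * Ω⁻¹` is strictly
proper. -/
structure Factorization where
  smith : (i : Fin N) → SmithForm (S.my i) (S.mv i) (S.Gyv i)
  NN : (i : Fin N) → Matrix (Fin (S.mz i)) (Fin (S.mv i)) ℝ[X]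
  DD : (i : Fin N) → Matrix (Fin (S.mv i)) (Fin (S.mv i)) ℝ[X]
  DD_det : ∀ i, (DD i).det ≠ 0
  NN_DD_coprime : ∀ i, IsRightCoprime (NN i) (DD i)
  Gzv_eq : ∀ i, S.Gzv i = polyRat (NN i) * (polyRat (DD i))⁻¹
  R : (i : Fin N) → Matrix (Fin (S.mv i)) {k : Fin (S.mv i) // (smith i).r ≤ (k : ℕ)} ℝ[X]
  Q : (i : Fin N) → Matrix (Fin (S.mv i)) {k : Fin (S.mv i) // (smith i).r ≤ (k : ℕ)} ℝ[X]
  Ω : (i : Fin N) → Matrix {k : Fin (S.mv i) // (smith i).r ≤ (k : ℕ)}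
    {k : Fin (S.mv i) // (smith i).r ≤ (k : ℕ)} ℝ[X]
  Ω_det : ∀ i, (Ω i).det ≠ 0
  Q_Ω_coprime : ∀ i, IsRightCoprime (Q i) (Ω i)
  Q_Ω_strict : ∀ i, IsStrictlyProper (polyRat (Q i) * (polyRat (Ω i))⁻¹)
  RQΩ_eq : ∀ i, (polyRat (DD i))⁻¹ * polyRat (smith i).Vinv2.transpose =
    polyRat (R i) + polyRat (Q i) * (polyRat (Ω i))⁻¹

namespace Factorization

variable {S} (F : S.Factorization)

/-- The number of null space directions of `G_yv(λ, i)`, i.e. of the rows of the second block of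
`V⁻¹`. -/
def nullDim (i : Fin N) : ℕ := S.mv i - (F.smith i).r

/-- Index type of the columns of the block diagonal matrices `Xhat` and `Yhat`. -/
abbrev NullIndex : Type := Σ i : Fin N, {k : Fin (S.mv i) // (F.smith i).r ≤ (k : ℕ)}

/-- The block diagonal polynomial matrix with blocks `Dzv (R Ω + Q)`. -/
def Xhat : Matrix (Stack S.mv) F.NullIndex ℝ[X] :=
  Matrix.blockDiagonal' fun i => F.DD i * (F.R i * F.Ω i + F.Q i)

/-- The block diagonal polynomial matrix with blocks `Nzv (R Ω + Q)`. -/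
def Yhat : Matrix (Stack S.mz) F.NullIndex ℝ[X] :=
  Matrix.blockDiagonal' fun i => F.NN i * (F.R i * F.Ω i + F.Q i)

/-- `Xhat - Φ₀ * Yhat`. -/
def pencil (Φ₀ : S.SCM) : Matrix (Stack S.mv) F.NullIndex ℝ[X] :=
  F.Xhat - Φ₀.map Polynomial.C * F.Yhat

end Factorization

end NDS

end

/-! Everything turns on one set: the constant real vectors `w` of the form `ω - Φ₀ G_zv ω`, where
`ω` is a rational vector with `G_yv ω = 0`. Over the field of rational functions the Smith-McMillan
forms of the `G_yv` describe this null space, and `Xhat`, `Yhat` only rescale its basis by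
invertible matrices, so such `w` are exactly the constant vectors in the column space of `Xhat - Φ₀
Yhat`. The Smith form of the pencil turns this into `Uinv2 w = 0`, and since `w` is constant, into
the vanishing of every coefficient matrix on `w`. Full column rank therefore says that `w = 0` is
the only such vector (`exists_pencil_mulVec_eq_iff`, `exists_mulVec_eq_iff`,
`stackedCoeffs_mulVec_eq_zero_iff`).

Rank implies identifiability. If `Φ ≠ Φ₀` differ in column `j`, full row rank of `G_zu` provides an
input for which the system with `Φ` has `z' = e_j`. Let `z` be the response of the system with `Φ₀`.
Were the outputs equal, `ω = Φ z' - Φ₀ z` would lie in the null space of `G_yv` and `ω - Φ₀ G_zv ω =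
(Φ - Φ₀) e_j` would be a nonzero constant. So the rational outputs differ. Clearing denominators and
letting polynomials in `δ` act on an elementary signal gives genuine trajectories from the zero
state with distinct outputs; these can be added to any common trajectory
(`differentiableSCM_of_isSolution`).

Identifiability implies rank. For a nonzero `w` in the set, put `Φ = Φ₀ + ε w e_jᵀ`, regular for
suitable `ε ≠ 0`. The difference of two trajectories obeys the equations with `Φ₀`, driven by the
scalar `ε z'_j` through `w`, and the transfer function from this scalar to the output is `G_yv ω =
0`. As `z'` need not be differentiable, no Laplace transform or repeated differentiation is
available; instead a polynomial identity reduces the claim to a linear autonomous system started at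
zero (`output_eq_zero`, `eq_zero_of_coeff_chain`). -/

open Matrix

/-! ## Signals -/

namespace TimeKind

/-- `df = δ(f)` for scalar signals. -/
def IsScalarDelta (τ : TimeKind) (f df : τ.Time → ℝ) : Prop :=
  τ.IsDelta (fun t (_ : Unit) => f t) (fun t _ => df t)

theorem isScalarDelta_continuous {f df : TimeKind.continuous.Time → ℝ} :
    TimeKind.continuous.IsScalarDelta f df ↔
      ∀ t : ℝ≥0, HasDerivWithinAt (fun s : ℝ => (f : ℝ≥0 → ℝ) s.toNNReal) ((df : ℝ≥0 → ℝ) t) (Set.Ici 0)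
        (t : ℝ) := by
  simp only [IsScalarDelta, IsDelta, hasDerivWithinAt_pi, forall_const]

theorem isScalarDelta_discrete {f df : TimeKind.discrete.Time → ℝ} :
    TimeKind.discrete.IsScalarDelta f df ↔ ∀ t : ℕ, (df : ℕ → ℝ) t = (f : ℕ → ℝ) (t + 1) := by
  simp only [IsScalarDelta, IsDelta, funext_iff, forall_const]

theorem isDelta_iff {n : Type} [Fintype n] (τ : TimeKind) (x dx : τ.Time → n → ℝ) :
    τ.IsDelta x dx ↔ ∀ i, τ.IsScalarDelta (fun t => x t i) (fun t => dx t i) := by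
  cases τ
  · simp_rw [isScalarDelta_continuous]
    simp only [IsDelta, hasDerivWithinAt_pi]
    exact forall_comm
  · simp_rw [isScalarDelta_discrete]
    simp only [IsDelta, funext_iff]
    exact forall_comm

variable {τ : TimeKind}

theorem IsScalarDelta.zero : τ.IsScalarDelta (fun _ => 0) (fun _ => 0) := by
  cases τ
  · exact isScalarDelta_continuous.2 fun t => hasDerivWithinAt_const _ _ _
  · exact isScalarDelta_discrete.2 fun t => rfl

theorem IsScalarDelta.add {f df g dg : τ.Time → ℝ} (hf : τ.IsScalarDelta f df)
    (hg : τ.IsScalarDelta g dg) :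
    τ.IsScalarDelta (fun t => f t + g t) (fun t => df t + dg t) := by
  cases τ
  · rw [isScalarDelta_continuous] at *
    exact fun t => (hf t).add (hg t)
  · rw [isScalarDelta_discrete] at *
    exact fun t => by rw [hf, hg]

theorem IsScalarDelta.const_mul {f df : τ.Time → ℝ} (c : ℝ) (hf : τ.IsScalarDelta f df) :
    τ.IsScalarDelta (fun t => c * f t) (fun t => c * df t) := by
  cases τ
  · rw [isScalarDelta_continuous] at *
    exact fun t => (hf t).const_mul c
  · rw [isScalarDelta_discrete] at *
    exact fun t => by rw [hf]

theorem IsScalarDelta.sum {ι : Type} (s : Finset ι) {f df : ι → τ.Time → ℝ}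
    (hf : ∀ i ∈ s, τ.IsScalarDelta (f i) (df i)) :
    τ.IsScalarDelta (fun t => ∑ i ∈ s, f i t) (fun t => ∑ i ∈ s, df i t) := by
  classical
  induction s using Finset.induction_on with
  | empty => simpa using IsScalarDelta.zero
  | insert a s ha ih =>
    simp only [Finset.sum_insert ha]
    exact (hf a (Finset.mem_insert_self a s)).add
      (ih fun i hi => hf i (Finset.mem_insert_of_mem hi))

/-- The one-sided derivative at time `0` is still unique, because `[0, ∞)` has unique derivatives at
each of its points. -/
theorem IsScalarDelta.unique {f df df' : τ.Time → ℝ} (h : τ.IsScalarDelta f df)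
    (h' : τ.IsScalarDelta f df') : df = df' := by
  cases τ
  · rw [isScalarDelta_continuous] at *
    funext (t : ℝ≥0)
    exact (uniqueDiffOn_Ici (0 : ℝ) _ (show (t : ℝ) ∈ Set.Ici 0 from t.2)).eq_deriv _ (h t) (h' t)
  · rw [isScalarDelta_discrete] at *
    funext (t : ℕ)
    exact (h t).trans (h' t).symm

theorem IsDelta.zero {n : Type} [Fintype n] : τ.IsDelta (fun _ (_ : n) => 0) (fun _ _ => 0) :=
  (isDelta_iff _ _ _).2 fun _ => IsScalarDelta.zero

theorem IsDelta.add {n : Type} [Fintype n] {x dx y dy : τ.Time → n → ℝ} (hx : τ.IsDelta x dx)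
    (hy : τ.IsDelta y dy) : τ.IsDelta (fun t => x t + y t) (fun t => dx t + dy t) :=
  (isDelta_iff _ _ _).2 fun i => ((isDelta_iff _ _ _).1 hx i).add ((isDelta_iff _ _ _).1 hy i)

theorem IsDelta.mulVec {m n : Type} [Fintype m] [Fintype n] (M : Matrix m n ℝ)
    {x dx : τ.Time → n → ℝ} (hx : τ.IsDelta x dx) :
    τ.IsDelta (fun t => M *ᵥ x t) (fun t => M *ᵥ dx t) :=
  (isDelta_iff _ _ _).2 fun i =>
    IsScalarDelta.sum _ fun j _ => ((isDelta_iff _ _ _).1 hx j).const_mul (M i j)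

theorem IsDelta.sub {n : Type} [Fintype n] {x dx y dy : τ.Time → n → ℝ} (hx : τ.IsDelta x dx)
    (hy : τ.IsDelta y dy) : τ.IsDelta (fun t => x t - y t) (fun t => dx t - dy t) := by
  classical
  have := hx.add (hy.mulVec (-1))
  simpa [sub_eq_add_neg, neg_mulVec] using this

/-- A solution of `δ(x) = M x` with `x(0) = 0` vanishes. -/
theorem IsDelta.eq_zero_of_linear {n : Type} [Fintype n] (M : Matrix n n ℝ)
    {x : τ.Time → n → ℝ} (h : τ.IsDelta x fun t => M *ᵥ x t) (h0 : x τ.start = 0) (t : τ.Time) :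
    x t = 0 := by
  classical
  cases τ
  · change ℝ≥0 at t
    change ℝ≥0 → n → ℝ at x
    have h1 : ∀ s ∈ Set.Ici (0 : ℝ), HasDerivWithinAt (fun s : ℝ => x s.toNNReal)
        (M *ᵥ x s.toNNReal) (Set.Ici 0) s := by
      intro s hs
      have := h s.toNNReal
      rwa [Real.coe_toNNReal s hs] at this
    let L : (n → ℝ) →L[ℝ] (n → ℝ) := LinearMap.toContinuousLinearMap (Matrix.mulVecLin M)
    -- Uniqueness for a globally Lipschitz field on `[0, t]`, compared with the zero solution.
    have key := ODE_solution_unique (v := fun _ y => M *ᵥ y) (K := ‖L‖₊)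
      (f := fun s : ℝ => x s.toNNReal) (g := fun _ => (0 : n → ℝ)) (a := 0) (b := (t : ℝ))
      (fun _ => L.lipschitz)
      (fun s hs => ((h1 s hs.1).mono Set.Icc_subset_Ici_self).continuousWithinAt)
      (fun s hs => (h1 s hs.1).mono (Set.Ici_subset_Ici.2 hs.1))
      continuousOn_const
      (fun s _ => by
        simp only [mulVec_zero]
        exact hasDerivWithinAt_const _ _ _)
      (by simpa [start] using h0)
    have := key (Set.right_mem_Icc.2 t.2)
    simpa using this
  · have h1 : ∀ s : ℕ, M *ᵥ x s = x (s + 1) := h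
    have : ∀ s : ℕ, x s = 0 := by
      intro s
      induction s with
      | zero => exact h0
      | succ s ih => rw [← h1, ih, mulVec_zero]
    exact this t

/-- If `π y = λ G - δ(G)` for some polynomial `G` in `λ` whose coefficients are signals that vanish
at time `0`, then `y = 0`. -/
theorem eq_zero_of_coeff_chain (p : ℝ[X]) (hp : p ≠ 0) (y : τ.Time → ℝ)
    (G dG : ℕ → τ.Time → ℝ) (hfin : ∃ n, ∀ k, n ≤ k → G k = 0) (hG0 : ∀ k, G k τ.start = 0)
    (hG : ∀ k, τ.IsScalarDelta (G k) (dG k))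
    (hsucc : ∀ k t, p.coeff (k + 1) * y t = G k t - dG (k + 1) t)
    (hzero : ∀ t, p.coeff 0 * y t = - dG 0 t) : y = 0 := by
  have dG_zero : ∀ k, G k = 0 → dG k = 0 := by
    intro k hk
    have := hG k
    rw [hk] at this
    exact this.unique IsScalarDelta.zero
  -- Descending induction from an index beyond which all `G k` vanish: above the degree of `p` the
  -- relation reads `0 = G k - δ(G (k + 1))`.
  have vanish : ∀ k, p.natDegree ≤ k → G k = 0 := by
    obtain ⟨n, hn⟩ := hfin
    intro k hk
    obtain ⟨j, hj⟩ : ∃ j, n ≤ k + j := ⟨n, by omega⟩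
    induction j generalizing k with
    | zero => exact hn k (by omega)
    | succ j ih =>
      have h1 := ih (k + 1) (by omega) (by omega)
      funext t
      have h2 := hsucc k t
      rw [dG_zero _ h1, coeff_eq_zero_of_natDegree_lt (by omega)] at h2
      simpa using h2.symm
  have lc : p.leadingCoeff ≠ 0 := leadingCoeff_ne_zero.2 hp
  rcases hd : p.natDegree with _ | m
  · have h0 : dG 0 = 0 := dG_zero 0 (vanish 0 (by omega))
    funext t
    have := hzero t
    rw [h0] at this
    have hc : p.coeff 0 ≠ 0 := by rwa [leadingCoeff, hd] at lc
    simpa [hc] using this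
  · have hc : p.coeff (m + 1) ≠ 0 := by rwa [leadingCoeff, hd] at lc
    -- The leading coefficient expresses `y` through the last nontrivial signal `G m`, which closes
    -- the chain.
    have hy : ∀ t, y t = (p.coeff (m + 1))⁻¹ * G m t := by
      intro t
      have h1 := hsucc m t
      rw [dG_zero _ (vanish (m + 1) (by omega))] at h1
      rw [eq_inv_mul_iff_mul_eq₀ hc, h1]
      simp
    -- A companion matrix of `p` made monic: `δ(G 0) = -p₀ y` and `δ(G (k+1)) = G k - p_{k+1} y`,
    -- with `y` replaced by a multiple of `G m`.
    let M : Matrix (Fin (m + 1)) (Fin (m + 1)) ℝ := Matrix.of fun k j =>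
      (if (j : ℕ) + 1 = k then 1 else 0) -
        (if j = Fin.last m then p.coeff k * (p.coeff (m + 1))⁻¹ else 0)
    have hlin : τ.IsDelta (fun t (k : Fin (m + 1)) => G k t)
        (fun t => M *ᵥ fun k : Fin (m + 1) => G k t) := by
      rw [isDelta_iff]
      intro k
      convert hG k using 2 with t
      simp only [M, mulVec, dotProduct, of_apply, sub_mul, Finset.sum_sub_distrib, ite_mul,
        zero_mul, one_mul, Finset.sum_ite_eq', Finset.mem_univ, if_true, Fin.val_last]
      rw [mul_assoc, ← hy]
      rcases k with ⟨_ | k, hk⟩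
      · simp [hzero]
      · have : ∀ j : Fin (m + 1), ((j : ℕ) + 1 = k + 1) ↔ j = ⟨k, by omega⟩ := by
          intro j
          simp [Fin.ext_iff]
        simp only [this, Finset.sum_ite_eq', Finset.mem_univ, if_true, hsucc]
        ring
    have := fun t => congrFun (hlin.eq_zero_of_linear M (funext fun k => hG0 k) t) (Fin.last m)
    funext t
    rw [hy]
    have h2 := this t
    simp only [Fin.val_last, Pi.zero_apply] at h2
    rw [h2]
    simp

/-- A single input descriptor system `E δ(ξ) = A ξ + b g`, `y = c ξ + d g` with zero transfer
function and `E ξ(0) = 0` has zero output, for an arbitrary scalar function `g`. -/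
theorem output_eq_zero {n : Type} [Fintype n] (E A : Matrix n n ℝ) (b c : n → ℝ) (d : ℝ)
    (p : ℝ[X]) (hp : p ≠ 0) (q : n → ℝ[X])
    (hq : q ᵥ* ((X : ℝ[X]) • E.map C - A.map C) = fun j => p * C (c j))
    (hqb : q ⬝ᵥ (fun i => C (b i)) = - (p * C d))
    (ξ de : τ.Time → n → ℝ) (g : τ.Time → ℝ) (h0 : E *ᵥ ξ τ.start = 0)
    (hδ : τ.IsDelta (fun t => E *ᵥ ξ t) de)
    (hde : ∀ t, de t = A *ᵥ ξ t + g t • b) (t : τ.Time) : c ⬝ᵥ ξ t + d * g t = 0 := by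
  -- Comparing coefficients of `q (λE - A) = p c` gives `p_{k+1} c = Q_k E - Q_{k+1} A`. Hence `G_k
  -- = Q_k E ξ` satisfies the hypotheses of `eq_zero_of_coeff_chain`, and only `E ξ` is ever
  -- differentiated, never `g` or all of `ξ`.
  let Q : ℕ → n → ℝ := fun k i => (q i).coeff k
  have hQ : ∀ j, p * C (c j) = X * (∑ i, q i * C (E i j)) - ∑ i, q i * C (A i j) := by
    intro j
    rw [← congrFun hq j]
    simp only [vecMul, dotProduct, Matrix.sub_apply, Matrix.smul_apply, map_apply, smul_eq_mul, mul_sub,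
      Finset.sum_sub_distrib, Finset.mul_sum]
    congr 1
    exact Finset.sum_congr rfl fun i _ => by ring
  have hsuccQ : ∀ k, p.coeff (k + 1) • c = Q k ᵥ* E - Q (k + 1) ᵥ* A := by
    intro k
    funext j
    have := congrArg (fun r => coeff r (k + 1)) (hQ j)
    simpa [coeff_X_mul, finsetSum_coeff, coeff_mul_C, vecMul, dotProduct, Q] using this
  have hzeroQ : p.coeff 0 • c = - (Q 0 ᵥ* A) := by
    funext j
    have := congrArg (fun r => coeff r 0) (hQ j)
    simpa [finsetSum_coeff, coeff_mul_C, vecMul, dotProduct, Q, mul_coeff_zero] using this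
  have hb : ∀ k, Q k ⬝ᵥ b = - (p.coeff k * d) := by
    intro k
    have := congrArg (fun r => coeff r k) hqb
    simpa [finsetSum_coeff, coeff_mul_C, dotProduct, Q] using this
  have hA : ∀ k t, Q k ⬝ᵥ de t = (Q k ᵥ* A) ⬝ᵥ ξ t - p.coeff k * d * g t := by
    intro k t
    rw [hde, dotProduct_add, dotProduct_smul, hb, dotProduct_mulVec, smul_eq_mul]
    ring
  have key := eq_zero_of_coeff_chain p hp (fun t => c ⬝ᵥ ξ t + d * g t)
    (fun k t => Q k ⬝ᵥ E *ᵥ ξ t) (fun k t => Q k ⬝ᵥ de t)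
    (by
      refine ⟨(∑ i, (q i).natDegree) + 1, fun k hk => ?_⟩
      have : Q k = 0 := by
        funext i
        refine coeff_eq_zero_of_natDegree_lt ?_
        have := Finset.single_le_sum (f := fun i => (q i).natDegree) (fun _ _ => Nat.zero_le _)
          (Finset.mem_univ i)
        omega
      funext t
      simp [this])
    (fun k => by simp [h0])
    (fun k => IsScalarDelta.sum _ fun i _ => ((isDelta_iff _ _ _).1 hδ i).const_mul (Q k i))
    (fun k t => by
      have h1 := congrArg (· ⬝ᵥ ξ t) (hsuccQ k)
      simp only [smul_dotProduct, sub_dotProduct, smul_eq_mul] at h1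
      rw [hA, dotProduct_mulVec, mul_add, h1]
      ring)
    (fun t => by
      have h1 := congrArg (· ⬝ᵥ ξ t) hzeroQ
      simp only [smul_dotProduct, neg_dotProduct, smul_eq_mul] at h1
      rw [hA, mul_add, h1]
      ring)
  exact congrFun key t

/-! ## Signals from polynomials -/

/-- The `k`-fold integral of the constant `1`, or the unit impulse at time `k`. -/
noncomputable def elementary : (τ : TimeKind) → ℕ → τ.Time → ℝ
  | .continuous => fun k (t : ℝ≥0) => (t : ℝ) ^ k / k.factorial
  | .discrete => fun k (t : ℕ) => if t = k then 1 else 0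

theorem elementary_start (k : ℕ) : τ.elementary (k + 1) τ.start = 0 := by
  cases τ <;> simp [elementary, start]

theorem isScalarDelta_elementary (k : ℕ) :
    τ.IsScalarDelta (τ.elementary (k + 1)) (τ.elementary k) := by
  cases τ
  · rw [isScalarDelta_continuous]
    intro t
    have h1 : HasDerivWithinAt (fun s : ℝ => s ^ (k + 1) / (k + 1).factorial)
        ((t : ℝ) ^ k / k.factorial) (Set.Ici 0) t := by
      have := ((hasDerivAt_pow (k + 1) (t : ℝ)).div_const ((k + 1).factorial : ℝ)).hasDerivWithinAt
        (s := Set.Ici 0)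
      refine this.congr_deriv ?_
      have h2 : (k.factorial : ℝ) ≠ 0 := by positivity
      have h3 : ((k : ℝ) + 1) ≠ 0 := by positivity
      rw [Nat.factorial_succ]
      push_cast
      field_simp
    refine h1.congr (fun s hs => ?_) ?_
    · simp [elementary, Real.coe_toNNReal s hs]
    · simp [elementary]
  · rw [isScalarDelta_discrete]
    intro t
    simp [elementary]

/-- In continuous time the combination is a polynomial vanishing on all of `[0, ∞)`; in discrete
time evaluation at time `k` isolates `a k`. -/
theorem elementary_linearIndependent (K : ℕ) (a : ℕ → ℝ)
    (h : ∀ t, ∑ k ∈ Finset.range K, a k * τ.elementary k t = 0) : ∀ k < K, a k = 0 := by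
  cases τ
  · let p : ℝ[X] := ∑ k ∈ Finset.range K, C (a k / k.factorial) * X ^ k
    have hp : p = 0 := by
      refine eq_zero_of_infinite_isRoot p ((Set.Ici_infinite (0 : ℝ)).mono fun s hs => ?_)
      have := h (⟨s, hs⟩ : ℝ≥0)
      simp only [elementary] at this
      change ∑ k ∈ Finset.range K, a k * (s ^ k / k.factorial) = 0 at this
      simp only [p, Set.mem_ofPred_eq, IsRoot, eval_finsetSum, eval_mul, eval_C, eval_pow, eval_X]
      rw [← this]
      exact Finset.sum_congr rfl fun k _ => by ring
    intro k hk
    have := congrArg (fun r => coeff r k) hp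
    simp only [p, finsetSum_coeff, coeff_C_mul, coeff_X_pow, mul_ite, mul_one, mul_zero,
      Finset.sum_ite_eq, Finset.mem_range, hk, if_true, coeff_zero] at this
    have h2 : (k.factorial : ℝ) ≠ 0 := by positivity
    simpa [h2] using this
  · intro k hk
    have := h (k : ℕ)
    simpa [elementary, hk] using this

/-- The signal `p(δ) e`, where `e` is the elementary signal of order `K`. -/
noncomputable def signal (τ : TimeKind) (K : ℕ) : ℝ[X] →ₗ[ℝ] (τ.Time → ℝ) :=
  ∑ k ∈ Finset.range (K + 1), (Polynomial.lcoeff ℝ k).smulRight (τ.elementary (K - k))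

theorem signal_apply (K : ℕ) (p : ℝ[X]) (t : τ.Time) :
    τ.signal K p t = ∑ k ∈ Finset.range (K + 1), p.coeff k * τ.elementary (K - k) t := by
  simp [signal, Finset.sum_apply]

/-- Only the elementary signal of order `0` is nonzero at the start, and its coefficient is that of
degree `K`. Hence the strict bound. -/
theorem signal_start {K : ℕ} {p : ℝ[X]} (hp : p.natDegree < K) : τ.signal K p τ.start = 0 := by
  rw [signal_apply]
  refine Finset.sum_eq_zero fun k hk => ?_
  rcases Nat.lt_or_ge k K with h | h
  · obtain ⟨j, hj⟩ : ∃ j, K - k = j + 1 := ⟨K - k - 1, by omega⟩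
    rw [hj, elementary_start, mul_zero]
  · rw [coeff_eq_zero_of_natDegree_lt (by omega), zero_mul]

/-- Since `δ` lowers the order of an elementary signal by one, it acts as multiplication by `X`. The
strict bound ensures that `X * p` loses no term to the truncation at degree `K`. -/
theorem isScalarDelta_signal {K : ℕ} {p : ℝ[X]} (hp : p.natDegree < K) :
    τ.IsScalarDelta (τ.signal K p) (τ.signal K (X * p)) := by
  have h1 : τ.signal K p = fun t =>
      ∑ k ∈ Finset.range K, p.coeff k * τ.elementary (K - k) t := by
    funext t
    rw [signal_apply, Finset.sum_range_succ, coeff_eq_zero_of_natDegree_lt hp, zero_mul, add_zero]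
  have h2 : τ.signal K (X * p) = fun t =>
      ∑ k ∈ Finset.range K, p.coeff k * τ.elementary (K - (k + 1)) t := by
    funext t
    rw [signal_apply, Finset.sum_range_succ']
    simp [coeff_X_mul]
  rw [h1, h2]
  refine IsScalarDelta.sum _ fun k hk => IsScalarDelta.const_mul _ ?_
  obtain ⟨j, rfl⟩ : ∃ j, K = k + j + 1 := ⟨K - k - 1, by have := Finset.mem_range.1 hk; omega⟩
  rw [show k + j + 1 - k = j + 1 by omega, show k + j + 1 - (k + 1) = j by omega]
  exact isScalarDelta_elementary j

theorem signal_injective {K : ℕ} {p : ℝ[X]} (hp : p.natDegree ≤ K) (h : τ.signal K p = 0) :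
    p = 0 := by
  have key := elementary_linearIndependent (τ := τ) (K + 1) (fun k => p.coeff (K - k)) (by
    intro t
    have := congrFun h t
    rw [signal_apply, ← Finset.sum_range_reflect] at this
    rw [← Pi.zero_apply (M := fun _ : τ.Time => ℝ) t, ← this]
    refine Finset.sum_congr rfl fun k hk => ?_
    have := Finset.mem_range.1 hk
    rw [show K + 1 - 1 - k = K - k by omega, show K - (K - k) = k by omega])
  ext k
  rcases Nat.lt_or_ge K k with hk | hk
  · exact coeff_eq_zero_of_natDegree_lt (by omega)
  · have := key (K - k) (by omega)
    rwa [show K - (K - k) = k by omega] at this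

/-- The vector signal `p(δ) e`. -/
noncomputable def signalVec (τ : TimeKind) (K : ℕ) {n : Type} (p : n → ℝ[X]) :
    τ.Time → n → ℝ :=
  fun t i => τ.signal K (p i) t

theorem signalVec_mulVec (K : ℕ) {m n : Type} [Fintype n] (M : Matrix m n ℝ) (p : n → ℝ[X])
    (t : τ.Time) : τ.signalVec K (M.map C *ᵥ p) t = M *ᵥ τ.signalVec K p t := by
  funext i
  simp only [signalVec, mulVec, dotProduct, map_apply, map_sum, C_mul', map_smul,
    Finset.sum_apply, Pi.smul_apply, smul_eq_mul]

theorem signalVec_add (K : ℕ) {n : Type} (p q : n → ℝ[X]) (t : τ.Time) :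
    τ.signalVec K (p + q) t = τ.signalVec K p t + τ.signalVec K q t := by
  funext i
  simp [signalVec]

theorem isDelta_signalVec {n : Type} [Fintype n] {K : ℕ} {p : n → ℝ[X]}
    (hp : ∀ i, (p i).natDegree < K) :
    τ.IsDelta (τ.signalVec K p) (τ.signalVec K fun i => X * p i) :=
  (isDelta_iff _ _ _).2 fun i => isScalarDelta_signal (hp i)

end TimeKind

/-! ## Rational matrices -/

theorem polyRat_mul {ι κ μ : Type} [Fintype κ] (A : Matrix ι κ ℝ[X]) (B : Matrix κ μ ℝ[X]) :
    polyRat (A * B) = polyRat A * polyRat B :=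
  Matrix.map_mul

theorem polyRat_add {ι κ : Type} (A B : Matrix ι κ ℝ[X]) :
    polyRat (A + B) = polyRat A + polyRat B :=
  Matrix.map_add _ (map_add _) _ _

theorem polyRat_sub {ι κ : Type} (A B : Matrix ι κ ℝ[X]) :
    polyRat (A - B) = polyRat A - polyRat B :=
  Matrix.map_sub _ (map_sub _) _ _

theorem polyRat_one {ι : Type} [DecidableEq ι] : polyRat (1 : Matrix ι ι ℝ[X]) = 1 :=
  Matrix.map_one _ (map_zero _) (map_one _)

theorem polyRat_map_C {ι κ : Type} (A : Matrix ι κ ℝ) : polyRat (A.map C) = constRat A := by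
  ext i j
  simp [polyRat, constRat, RatFunc.algebraMap_C]

theorem polyRat_mulVec {ι κ : Type} [Fintype κ] (A : Matrix ι κ ℝ[X]) (p : κ → ℝ[X]) :
    (polyRat A *ᵥ fun j => algebraMap ℝ[X] (RatFunc ℝ) (p j)) =
      fun i => algebraMap ℝ[X] (RatFunc ℝ) ((A *ᵥ p) i) := by
  funext i
  exact (RingHom.map_mulVec (algebraMap ℝ[X] (RatFunc ℝ)) A p i).symm

theorem det_polyRat {ι : Type} [Fintype ι] [DecidableEq ι] (A : Matrix ι ι ℝ[X]) :
    (polyRat A).det = algebraMap ℝ[X] (RatFunc ℝ) A.det :=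
  ((algebraMap ℝ[X] (RatFunc ℝ)).map_det A).symm

theorem isUnit_det_polyRat {ι : Type} [Fintype ι] [DecidableEq ι] {A : Matrix ι ι ℝ[X]}
    (h : A.det ≠ 0) : IsUnit (polyRat A).det := by
  rw [det_polyRat, isUnit_iff_ne_zero]
  exact (map_ne_zero_iff _ (RatFunc.algebraMap_injective ℝ)).2 h

theorem constRat_mul {ι κ μ : Type} [Fintype κ] (A : Matrix ι κ ℝ) (B : Matrix κ μ ℝ) :
    constRat (A * B) = constRat A * constRat B :=
  Matrix.map_mul

/-- The pencil `λ E - A` as a polynomial matrix. -/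
noncomputable def polyPencil {n : Type} (E A : Matrix n n ℝ) : Matrix n n ℝ[X] :=
  (X : ℝ[X]) • E.map C - A.map C

theorem polyRat_polyPencil {n : Type} (E A : Matrix n n ℝ) :
    polyRat (polyPencil E A) = (RatFunc.X : RatFunc ℝ) • constRat E - constRat A := by
  ext i j
  simp [polyRat, constRat, polyPencil, RatFunc.algebraMap_C, RatFunc.algebraMap_X]
  exact mul_comm _ _

theorem IsRegularPencil.det_polyPencil_ne_zero {n : Type} [Fintype n] [DecidableEq n]
    {E A : Matrix n n ℝ} (h : IsRegularPencil E A) : (polyPencil E A).det ≠ 0 := by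
  obtain ⟨s, hs⟩ := h
  intro h0
  apply hs
  have h1 := (aeval (R := ℝ) s).toRingHom.map_det (polyPencil E A)
  rw [h0, map_zero] at h1
  rw [h1]
  congr 1
  ext i j
  simp [polyPencil]
  exact mul_comm _ _

/-! ### Block diagonal matrices and transfer functions -/

theorem blockDiagonal'_mulVec_apply {R o : Type} [CommRing R] [Fintype o] [DecidableEq o]
    {m n : o → Type} [∀ i, Fintype (n i)]
    (M : ∀ i, Matrix (m i) (n i) R) (w : (Σ i, n i) → R) (i : o) (a : m i) :
    (blockDiagonal' M *ᵥ w) ⟨i, a⟩ = (M i *ᵥ fun b => w ⟨i, b⟩) a := by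
  simp only [mulVec, dotProduct, Fintype.sum_sigma]
  rw [Finset.sum_eq_single i]
  · simp
  · intro j _ hj
    exact Finset.sum_eq_zero fun b _ => by rw [blockDiagonal'_apply_ne _ _ _ hj.symm, zero_mul]
  · simp

theorem constRat_blockDiagonal' {o : Type} [DecidableEq o] {m n : o → Type}
    (M : ∀ i, Matrix (m i) (n i) ℝ) :
    constRat (blockDiagonal' M) = blockDiagonal' fun i => constRat (M i) :=
  blockDiagonal'_map _ _ (map_zero _)

theorem polyRat_blockDiagonal' {o : Type} [DecidableEq o] {m n : o → Type}
    (M : ∀ i, Matrix (m i) (n i) ℝ[X]) :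
    polyRat (blockDiagonal' M) = blockDiagonal' fun i => polyRat (M i) :=
  blockDiagonal'_map _ _ (map_zero _)

theorem blockDiagonal'_mul_inv {o : Type} [Fintype o] [DecidableEq o] {m : o → Type}
    [∀ i, Fintype (m i)] [∀ i, DecidableEq (m i)] {K : Type} [Field K]
    {M : ∀ i, Matrix (m i) (m i) K} (h : ∀ i, IsUnit (M i).det) :
    blockDiagonal' M * blockDiagonal' (fun i => (M i)⁻¹) = 1 := by
  rw [← blockDiagonal'_mul]
  simp_rw [fun i => mul_nonsing_inv (M i) (h i)]
  exact blockDiagonal'_one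

/-- Regularity of every block is essential: the inverse of a singular matrix is `0` by convention,
so one singular block would annihilate the inverse of the whole pencil. -/
theorem transferMatrix_blockDiagonal' {o : Type} [Fintype o] [DecidableEq o] {n p q : o → Type}
    [∀ i, Fintype (n i)] [∀ i, DecidableEq (n i)] [∀ i, Fintype (q i)]
    {E A : ∀ i, Matrix (n i) (n i) ℝ} (B : ∀ i, Matrix (n i) (q i) ℝ)
    (C : ∀ i, Matrix (p i) (n i) ℝ) (D : ∀ i, Matrix (p i) (q i) ℝ)
    (h : ∀ i, IsRegularPencil (E i) (A i)) :
    transferMatrix (blockDiagonal' E) (blockDiagonal' A) (blockDiagonal' B) (blockDiagonal' C)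
      (blockDiagonal' D) = blockDiagonal' fun i => transferMatrix (E i) (A i) (B i) (C i) (D i) := by
  have hu : ∀ i, IsUnit ((RatFunc.X : RatFunc ℝ) • constRat (E i) - constRat (A i)).det := by
    intro i
    rw [← polyRat_polyPencil]
    exact isUnit_det_polyRat (h i).det_polyPencil_ne_zero
  have hP : (RatFunc.X : RatFunc ℝ) • constRat (blockDiagonal' E) - constRat (blockDiagonal' A) =
      blockDiagonal' fun i => (RatFunc.X : RatFunc ℝ) • constRat (E i) - constRat (A i) := by
    rw [constRat_blockDiagonal', constRat_blockDiagonal', ← blockDiagonal'_smul,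
      ← blockDiagonal'_sub]
    rfl
  simp only [transferMatrix]
  rw [hP, inv_eq_right_inv (blockDiagonal'_mul_inv hu), constRat_blockDiagonal',
    constRat_blockDiagonal', constRat_blockDiagonal', ← blockDiagonal'_mul, ← blockDiagonal'_mul,
    ← blockDiagonal'_add]
  rfl

theorem isUnit_det_blockDiagonal'_pencil {o : Type} [Fintype o] [DecidableEq o] {n : o → Type}
    [∀ i, Fintype (n i)] [∀ i, DecidableEq (n i)]
    {E A : ∀ i, Matrix (n i) (n i) ℝ} (h : ∀ i, IsRegularPencil (E i) (A i)) :
    IsUnit ((RatFunc.X : RatFunc ℝ) • constRat (blockDiagonal' E) -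
      constRat (blockDiagonal' A)).det := by
  have hu : ∀ i, IsUnit ((RatFunc.X : RatFunc ℝ) • constRat (E i) - constRat (A i)).det := by
    intro i
    rw [← polyRat_polyPencil]
    exact isUnit_det_polyRat (h i).det_polyPencil_ne_zero
  have hP : (RatFunc.X : RatFunc ℝ) • constRat (blockDiagonal' E) - constRat (blockDiagonal' A) =
      blockDiagonal' fun i => (RatFunc.X : RatFunc ℝ) • constRat (E i) - constRat (A i) := by
    rw [constRat_blockDiagonal', constRat_blockDiagonal', ← blockDiagonal'_smul,
      ← blockDiagonal'_sub]
    rfl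
  rw [hP]
  exact isUnit_det_of_right_inverse (blockDiagonal'_mul_inv hu)

/-- A finite family of rational functions has a common denominator. -/
theorem exists_common_denominator {ι : Type} [Finite ι] (f : ι → RatFunc ℝ) :
    ∃ (p : ℝ[X]) (g : ι → ℝ[X]), p ≠ 0 ∧
      ∀ i, algebraMap ℝ[X] (RatFunc ℝ) (g i) = algebraMap ℝ[X] (RatFunc ℝ) p * f i := by
  obtain ⟨b, hb⟩ := IsLocalization.exist_integer_multiples_of_finite (nonZeroDivisors ℝ[X]) f
  choose g hg using hb
  exact ⟨b, g, nonZeroDivisors.coe_ne_zero b, fun i => by rw [hg, Algebra.smul_def]⟩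

/-! ### Normal rank and rank over the field of rational functions -/

theorem exists_submatrix_det_ne_zero {K ι κ : Type} [Field K] [Fintype ι] [DecidableEq ι]
    [Fintype κ] (M : Matrix ι κ K) (h : M.rank = Fintype.card ι) :
    ∃ f : ι → κ, (M.submatrix id f).det ≠ 0 := by
  obtain ⟨κ', a, ha, hspan, hli⟩ := exists_linearIndependent' K M.col
  have : Finite κ' := Finite.of_injective a ha
  have := Fintype.ofFinite κ'
  have hcard : Fintype.card ι = Fintype.card κ' := by
    rw [← h, rank_eq_finrank_span_cols, ← hspan, finrank_span_eq_card hli]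
  let e := Fintype.equivOfCardEq hcard
  refine ⟨a ∘ e, ?_⟩
  have : LinearIndependent K (M.submatrix id (a ∘ e)).col := hli.comp e e.injective
  rw [linearIndependent_cols_iff_isUnit, isUnit_iff_isUnit_det] at this
  exact this.ne_zero

/-- Evaluation at `s` is not a ring homomorphism on rational functions. Multiplying by the product
`q` of all denominators, which is nonzero at `s`, moves the question to polynomials, where
evaluation commutes with determinants. -/
theorem det_ne_zero_of_eval_det_ne_zero {ι : Type} [Fintype ι] [DecidableEq ι]
    (M : Matrix ι ι (RatFunc ℝ)) (s : ℂ) (hs : ∀ i j, aeval s (M i j).denom ≠ 0)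
    (h : (M.map (RatFunc.eval (algebraMap ℝ ℂ) s)).det ≠ 0) : M.det ≠ 0 := by
  let q : ℝ[X] := ∏ i, ∏ j, (M i j).denom
  have hq : aeval s q ≠ 0 := by
    simp only [q, map_prod]
    exact Finset.prod_ne_zero_iff.2 fun i _ => Finset.prod_ne_zero_iff.2 fun j _ => hs i j
  have hdvd : ∀ i j, (M i j).denom ∣ q := fun i j =>
    (Finset.dvd_prod_of_mem (fun j => (M i j).denom) (Finset.mem_univ j)).trans
      (Finset.dvd_prod_of_mem (fun i => ∏ j, (M i j).denom) (Finset.mem_univ i))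
  choose c hc using hdvd
  let Mp : Matrix ι ι ℝ[X] := Matrix.of fun i j => (M i j).num * c i j
  have hrat : polyRat Mp = (algebraMap ℝ[X] (RatFunc ℝ) q) • M := by
    ext i j
    have hden : algebraMap ℝ[X] (RatFunc ℝ) (M i j).denom ≠ 0 :=
      (map_ne_zero_iff _ (RatFunc.algebraMap_injective ℝ)).2 (M i j).denom_ne_zero
    simp only [polyRat, Mp, map_apply, of_apply, map_mul, Matrix.smul_apply, smul_eq_mul]
    have hM := RatFunc.num_div_denom (M i j)
    rw [div_eq_iff hden] at hM
    rw [hM, hc i j, map_mul]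
    ring
  have heval : Mp.map (aeval s) = (aeval s q) • M.map (RatFunc.eval (algebraMap ℝ ℂ) s) := by
    ext i j
    have hden := hs i j
    simp only [Mp, map_apply, of_apply, map_mul, Matrix.smul_apply, smul_eq_mul, RatFunc.eval]
    rw [hc i j, map_mul, ← aeval_def, ← aeval_def]
    field_simp
  have hdet : Mp.det ≠ 0 := by
    intro h0
    have h1 := (aeval (R := ℝ) s).toRingHom.map_det Mp
    rw [h0, map_zero] at h1
    have h2 : (Mp.map (aeval s)).det = 0 := h1.symm
    rw [heval, det_smul] at h2
    exact mul_ne_zero (pow_ne_zero _ hq) h h2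
  intro h0
  have h1 := (isUnit_det_polyRat hdet).ne_zero
  rw [hrat, det_smul, h0, mul_zero] at h1
  exact h1 rfl

/-- A rational matrix of full normal row rank is surjective over the field of rational
functions. -/
theorem IsFNRR.exists_mulVec_eq {ι κ : Type} [Fintype ι] [Fintype κ]
    {M : Matrix ι κ (RatFunc ℝ)} (h : IsFNRR M) (b : ι → RatFunc ℝ) : ∃ a, M *ᵥ a = b := by
  classical
  rcases isEmpty_or_nonempty ι with hι | hι
  · exact ⟨0, Subsingleton.elim _ _⟩
  unfold IsFNRR normalRank at h
  set A := {r : ℕ | ∃ s : ℂ, (∀ i j, Polynomial.aeval s (M i j).denom ≠ 0) ∧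
    r = (M.map (RatFunc.eval (algebraMap ℝ ℂ) s)).rank} with hA
  -- In `ℕ` the supremum of the empty set is `0`, which cannot equal the positive number of rows.
  have hne : A.Nonempty := by
    by_contra hempty
    rw [Set.not_nonempty_iff_eq_empty.1 hempty, csSup_empty] at h
    exact Fintype.card_ne_zero h.symm
  have hbdd : BddAbove A := by
    refine ⟨Fintype.card ι, ?_⟩
    rintro _ ⟨s, -, rfl⟩
    exact rank_le_card_height _
  have hmem := Nat.sSup_mem hne hbdd
  rw [h] at hmem
  obtain ⟨s, hs, hr⟩ := hmem
  obtain ⟨f, hf⟩ := exists_submatrix_det_ne_zero _ hr.symm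
  have hdet : (M.submatrix id f).det ≠ 0 :=
    det_ne_zero_of_eval_det_ne_zero _ s (fun i j => hs i (f j)) hf
  -- This selection matrix picks the columns of a nonsingular square submatrix; the square system is
  -- solved and the solution embedded by it.
  have hmul : M * (1 : Matrix κ κ (RatFunc ℝ)).submatrix id f = M.submatrix id f := by
    ext i j
    simp [mul_apply, one_apply]
  refine ⟨(1 : Matrix κ κ (RatFunc ℝ)).submatrix id f *ᵥ ((M.submatrix id f)⁻¹ *ᵥ b), ?_⟩
  rw [mulVec_mulVec, hmul, mulVec_mulVec, mul_nonsing_inv _ (isUnit_iff_ne_zero.2 hdet),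
    one_mulVec]

/-! ### Constant vectors killed by a polynomial matrix -/

theorem isFCR_iff {ι κ : Type} [Fintype ι] [Fintype κ] (M : Matrix ι κ ℝ) :
    IsFCR M ↔ ∀ w, M *ᵥ w = 0 → w = 0 := by
  have h1 := LinearMap.finrank_range_add_finrank_ker M.mulVecLin
  rw [Module.finrank_fintype_fun_eq_card] at h1
  have h2 : IsFCR M ↔ Module.finrank ℝ (LinearMap.ker M.mulVecLin) = 0 := by
    unfold IsFCR rank
    omega
  rw [h2, Submodule.finrank_eq_zero, LinearMap.ker_eq_bot']
  rfl

/-- For constant `w`, the coefficient of `λ^k` in `P w` is `P_k w`. This is where the rational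
condition becomes a real rank condition. -/
theorem stackedCoeffs_mulVec_eq_zero_iff {ι κ : Type} [Fintype ι] [Fintype κ]
    (P : Matrix ι κ ℝ[X]) (w : κ → ℝ) :
    stackedCoeffs P *ᵥ w = 0 ↔ P *ᵥ (fun j => C (w j)) = 0 := by
  have hcoeff : ∀ i k, ((P *ᵥ fun j => C (w j)) i).coeff k = ∑ j, (P i j).coeff k * w j := by
    intro i k
    simp [mulVec, dotProduct, finsetSum_coeff, coeff_mul_C]
  constructor
  · intro h
    funext i
    ext k
    rw [hcoeff]
    rcases Nat.lt_or_ge k (matDegree P + 1) with hk | hk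
    · exact congrFun h (⟨k, hk⟩, i)
    · refine Finset.sum_eq_zero fun j _ => ?_
      have h1 : (P i j).natDegree ≤ matDegree P :=
        (Finset.le_sup (f := fun j => (P i j).natDegree) (Finset.mem_univ j)).trans
          (Finset.le_sup (f := fun i => Finset.univ.sup fun j => (P i j).natDegree)
            (Finset.mem_univ i))
      rw [coeff_eq_zero_of_natDegree_lt (by omega), zero_mul]
  · intro h
    funext a
    have := congrArg (fun p => coeff p (a.1 : ℕ)) (congrFun h a.2)
    simp only [hcoeff] at this
    exact this

/-! ## Kernel and image from a Smith-McMillan form -/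

theorem rectDiag_mulVec {R : Type} [CommRing R] {m n r : ℕ} (d : Fin r → R) (hn : r ≤ n)
    (c : Fin n → R) (a : Fin m) :
    (rectDiag m n d *ᵥ c) a =
      if h : (a : ℕ) < r then d ⟨a, h⟩ * c ⟨a, h.trans_le hn⟩ else 0 := by
  simp only [mulVec, dotProduct, rectDiag, of_apply]
  split_ifs with h
  · have : ∀ b : Fin n, (b : ℕ) = a ↔ b = ⟨a, h.trans_le hn⟩ := fun b => by simp [Fin.ext_iff]
    simp [this]
  · simp

namespace SmithForm

variable {ι κ : Type} [Fintype ι] [DecidableEq ι] [Fintype κ] [DecidableEq κ] {m n : ℕ}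

/-- A Smith form of a polynomial matrix as a Smith-McMillan form. -/
noncomputable def toRatFunc {M : Matrix ι κ ℝ[X]} (S : SmithForm m n M) :
    SmithForm m n (polyRat M) where
  r := S.r
  r_le_m := S.r_le_m
  r_le_n := S.r_le_n
  U := S.U
  Uinv := S.Uinv
  V := S.V
  Vinv := S.Vinv
  U_mul_Uinv := S.U_mul_Uinv
  Uinv_mul_U := S.Uinv_mul_U
  V_mul_Vinv := S.V_mul_Vinv
  Vinv_mul_V := S.Vinv_mul_V
  d := fun j => algebraMap ℝ[X] (RatFunc ℝ) (S.d j)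
  d_ne_zero := fun j => (map_ne_zero_iff _ (RatFunc.algebraMap_injective ℝ)).2 (S.d_ne_zero j)
  eq_mul := by
    have h1 : rectDiag m n (fun j => algebraMap ℝ[X] (RatFunc ℝ) (S.d j)) =
        polyRat (rectDiag m n S.d) := by
      ext a b
      simp only [rectDiag, polyRat, of_apply, map_apply]
      split_ifs <;> simp
    have h2 := congrArg polyRat S.eq_mul
    rw [polyRat_mul, polyRat_mul] at h2
    rw [h1, h2]
    simp only [Algebra.algebraMap_self, polyRat, Matrix.map_map, transpose_map]
    rfl

variable {M : Matrix ι κ (RatFunc ℝ)} (S : SmithForm m n M)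

theorem mulVec_eq (a : κ → RatFunc ℝ) :
    M *ᵥ a = polyRat S.U *ᵥ (rectDiag m n S.d *ᵥ ((polyRat S.V)ᵀ *ᵥ a)) := by
  conv_lhs => rw [S.eq_mul]
  rw [mulVec_mulVec, mulVec_mulVec]
  rfl

/-- In the coordinates `c = Vᵀ a` the matrix is diagonal with nonzero `d j`, so the kernel is given
by the vanishing of the first `r` coordinates; transforming back uses `V⁻ᵀ`. -/
theorem mulVec_eq_zero_iff (a : κ → RatFunc ℝ) :
    M *ᵥ a = 0 ↔ ∃ b, a = polyRat S.Vinv2ᵀ *ᵥ b := by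
  have hUU : polyRat S.Uinv * polyRat S.U = 1 := by
    rw [← polyRat_mul, S.Uinv_mul_U, polyRat_one]
  have hVV : polyRat S.Vinv * polyRat S.V = 1 := by
    rw [← polyRat_mul, S.Vinv_mul_V, polyRat_one]
  have hVV' : (polyRat S.Vinv)ᵀ * (polyRat S.V)ᵀ = 1 := by
    rw [← transpose_mul, ← polyRat_mul, S.V_mul_Vinv, polyRat_one, transpose_one]
  constructor
  · intro h
    rw [S.mulVec_eq] at h
    have h1 := congrArg (polyRat S.Uinv *ᵥ ·) h
    simp only [mulVec_zero] at h1
    rw [mulVec_mulVec, hUU, one_mulVec] at h1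
    set c := (polyRat S.V)ᵀ *ᵥ a with hc
    have hc0 : ∀ k : Fin n, ¬ S.r ≤ (k : ℕ) → c k = 0 := by
      intro k hk
      have hk' : (k : ℕ) < S.r := not_le.1 hk
      have h2 := congrFun h1 ⟨k, hk'.trans_le S.r_le_m⟩
      rw [rectDiag_mulVec _ S.r_le_n, dif_pos hk'] at h2
      exact (mul_eq_zero.1 h2).resolve_left (S.d_ne_zero _)
    refine ⟨fun k => c k, ?_⟩
    have ha : a = (polyRat S.Vinv)ᵀ *ᵥ c := by rw [hc, mulVec_mulVec, hVV', one_mulVec]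
    rw [ha]
    funext i
    simp only [mulVec, dotProduct]
    rw [← Fintype.sum_subtype_add_sum_subtype (fun k : Fin n => S.r ≤ (k : ℕ)),
      Finset.sum_eq_zero (s := (Finset.univ : Finset {k : Fin n // ¬ S.r ≤ (k : ℕ)}))
        (fun k _ => by rw [hc0 k k.2, mul_zero]), add_zero]
    rfl
  · rintro ⟨b, rfl⟩
    have hV2 : (polyRat S.V)ᵀ * polyRat S.Vinv2ᵀ =
        (1 : Matrix (Fin n) (Fin n) (RatFunc ℝ)).submatrix id Subtype.val := by
      have h1 := congrArg (fun A : Matrix (Fin n) (Fin n) (RatFunc ℝ) =>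
        (A.submatrix (Subtype.val : {k : Fin n // S.r ≤ (k : ℕ)} → Fin n) id)ᵀ) hVV
      simp only [transpose_submatrix, transpose_one, transpose_mul] at h1
      rw [← h1]
      rfl
    rw [S.mulVec_eq, mulVec_mulVec _ (polyRat S.V)ᵀ, hV2]
    refine (congrArg (polyRat S.U *ᵥ ·) ?_).trans (mulVec_zero _)
    funext k
    rw [rectDiag_mulVec _ S.r_le_n]
    split_ifs with hk
    · rw [Pi.zero_apply, mul_eq_zero]
      right
      simp only [mulVec, dotProduct]
      refine Finset.sum_eq_zero fun j _ => ?_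
      rw [submatrix_apply, one_apply_ne, zero_mul]
      intro h
      have := congrArg Fin.val h
      simp only [id] at this
      have := j.2
      omega
    · rfl

/-- In the coordinates `U⁻¹ w` the image consists of the vectors supported on the first `r` entries.
Dividing by the `d j` requires rational, not polynomial, preimages. -/
theorem exists_mulVec_eq_iff (w : ι → RatFunc ℝ) :
    (∃ a, M *ᵥ a = w) ↔ polyRat S.Uinv2 *ᵥ w = 0 := by
  have hUU : polyRat S.Uinv * polyRat S.U = 1 := by
    rw [← polyRat_mul, S.Uinv_mul_U, polyRat_one]
  have hUU' : polyRat S.U * polyRat S.Uinv = 1 := by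
    rw [← polyRat_mul, S.U_mul_Uinv, polyRat_one]
  have hVV' : (polyRat S.V)ᵀ * (polyRat S.Vinv)ᵀ = 1 := by
    rw [← transpose_mul, ← polyRat_mul, S.Vinv_mul_V, polyRat_one, transpose_one]
  have hU2 : ∀ k, (polyRat S.Uinv2 *ᵥ w) k = (polyRat S.Uinv *ᵥ w) k.1 := fun k => rfl
  constructor
  · rintro ⟨a, rfl⟩
    funext k
    rw [hU2, S.mulVec_eq, mulVec_mulVec, hUU, one_mulVec, rectDiag_mulVec _ S.r_le_n,
      dif_neg (not_lt.2 k.2)]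
    rfl
  · intro h
    set e := polyRat S.Uinv *ᵥ w with he
    let c : Fin n → RatFunc ℝ := fun k =>
      if hk : (k : ℕ) < S.r then (S.d ⟨k, hk⟩)⁻¹ * e ⟨k, hk.trans_le S.r_le_m⟩ else 0
    refine ⟨(polyRat S.Vinv)ᵀ *ᵥ c, ?_⟩
    rw [S.mulVec_eq, mulVec_mulVec _ (polyRat S.V)ᵀ, hVV', one_mulVec]
    have : rectDiag m n S.d *ᵥ c = e := by
      funext k
      rw [rectDiag_mulVec _ S.r_le_n]
      split_ifs with hk
      · simp only [c, dif_pos hk]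
        rw [mul_inv_cancel_left₀ (S.d_ne_zero _)]
      · exact (congrFun h ⟨k, not_lt.1 hk⟩).symm
    rw [this, he, mulVec_mulVec, hUU', one_mulVec]

end SmithForm

namespace NDS

variable {N : ℕ} (S : NDS N)

/-! ## The stacked system equations -/

/-- The block diagonal matrix of the `E i`. -/
abbrev stackE : Matrix (Stack S.mx) (Stack S.mx) ℝ := blockDiagonal' S.E
/-- The block diagonal matrix of the `Axx i`. -/
abbrev stackAxx : Matrix (Stack S.mx) (Stack S.mx) ℝ := blockDiagonal' S.Axx
/-- The block diagonal matrix of the `Bxv i`. -/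
abbrev stackBxv : Matrix (Stack S.mx) (Stack S.mv) ℝ := blockDiagonal' S.Bxv
/-- The block diagonal matrix of the `Bxu i`. -/
abbrev stackBxu : Matrix (Stack S.mx) (Stack S.mu) ℝ := blockDiagonal' S.Bxu
/-- The block diagonal matrix of the `Czx i`. -/
abbrev stackCzx : Matrix (Stack S.mz) (Stack S.mx) ℝ := blockDiagonal' S.Czx
/-- The block diagonal matrix of the `Dzv i`. -/
abbrev stackDzv : Matrix (Stack S.mz) (Stack S.mv) ℝ := blockDiagonal' S.Dzv
/-- The block diagonal matrix of the `Dzu i`. -/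
abbrev stackDzu : Matrix (Stack S.mz) (Stack S.mu) ℝ := blockDiagonal' S.Dzu
/-- The block diagonal matrix of the `Cyx i`. -/
abbrev stackCyx : Matrix (Stack S.my) (Stack S.mx) ℝ := blockDiagonal' S.Cyx
/-- The block diagonal matrix of the `Dyv i`. -/
abbrev stackDyv : Matrix (Stack S.my) (Stack S.mv) ℝ := blockDiagonal' S.Dyv
/-- The block diagonal matrix of the `Dyu i`. -/
abbrev stackDyu : Matrix (Stack S.my) (Stack S.mu) ℝ := blockDiagonal' S.Dyu

theorem eq_iff_block_eq {m : Fin N → ℕ} (a b : Stack m → ℝ) :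
    a = b ↔ ∀ i, block a i = block b i := by
  simp only [funext_iff, block, Sigma.forall]

theorem block_mulVec {m n : Fin N → ℕ} (M : ∀ i, Matrix (Fin (m i)) (Fin (n i)) ℝ)
    (w : Stack n → ℝ) (i : Fin N) :
    block (blockDiagonal' M *ᵥ w) i = M i *ᵥ block w i :=
  funext fun a => blockDiagonal'_mulVec_apply M w i a

theorem block_add {m : Fin N → ℕ} (a b : Stack m → ℝ) (i : Fin N) :
    block (a + b) i = block a i + block b i :=
  rfl

variable {S} {τ : TimeKind}

theorem isOutput_iff (Φ : S.SCM) (x₀ : Stack S.mx → ℝ) (u : τ.Time → Stack S.mu → ℝ)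
    (y : τ.Time → Stack S.my → ℝ) :
    S.IsOutput τ Φ x₀ u y ↔
      ∃ (x dx : τ.Time → Stack S.mx → ℝ) (z : τ.Time → Stack S.mz → ℝ),
        x τ.start = x₀ ∧ τ.IsDelta x dx ∧ ∀ t,
          S.stackE *ᵥ dx t =
            S.stackAxx *ᵥ x t + S.stackBxv *ᵥ (Φ *ᵥ z t) + S.stackBxu *ᵥ u t ∧
          z t = S.stackCzx *ᵥ x t + S.stackDzv *ᵥ (Φ *ᵥ z t) + S.stackDzu *ᵥ u t ∧
          y t = S.stackCyx *ᵥ x t + S.stackDyv *ᵥ (Φ *ᵥ z t) + S.stackDyu *ᵥ u t := by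
  simp only [eq_iff_block_eq (m := S.mx) (S.stackE *ᵥ _), eq_iff_block_eq (m := S.mz),
    eq_iff_block_eq (m := S.my), block_add, block_mulVec, ← forall_and]
  constructor
  · rintro ⟨x, dx, v, z, h0, hδ, hv, h⟩
    exact ⟨x, dx, z, h0, hδ, fun t i => by rw [← hv]; exact h t i⟩
  · rintro ⟨x, dx, z, h0, hδ, h⟩
    exact ⟨x, dx, fun t => Φ *ᵥ z t, z, h0, hδ, fun _ => rfl, h⟩

theorem IsOutput.add {Φ : S.SCM} {x₀ x₁ : Stack S.mx → ℝ} {u₀ u₁ : τ.Time → Stack S.mu → ℝ}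
    {y₀ y₁ : τ.Time → Stack S.my → ℝ} (h₀ : S.IsOutput τ Φ x₀ u₀ y₀)
    (h₁ : S.IsOutput τ Φ x₁ u₁ y₁) :
    S.IsOutput τ Φ (x₀ + x₁) (fun t => u₀ t + u₁ t) (fun t => y₀ t + y₁ t) := by
  rw [isOutput_iff] at *
  obtain ⟨x, dx, z, h0, hδ, h⟩ := h₀
  obtain ⟨x', dx', z', h0', hδ', h'⟩ := h₁
  refine ⟨fun t => x t + x' t, fun t => dx t + dx' t, fun t => z t + z' t, congrArg₂ _ h0 h0',
    hδ.add hδ', fun t => ⟨?_, ?_, ?_⟩⟩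
  · simp only [mulVec_add, (h t).1, (h' t).1]
    abel
  · refine (congrArg₂ _ (h t).2.1 (h' t).2.1).trans ?_
    simp only [mulVec_add]
    abel
  · simp only [mulVec_add, (h t).2.2, (h' t).2.2]
    abel

theorem isOutput_zero (Φ : S.SCM) : S.IsOutput τ Φ 0 (fun _ => 0) (fun _ => 0) := by
  rw [isOutput_iff]
  exact ⟨fun _ => 0, fun _ => 0, fun _ => 0, rfl, TimeKind.IsDelta.zero, fun t => by simp⟩

/-! ## Solutions in the operator domain -/

variable (S)

/-- The system equations in the operator domain: `s` stands for the operator `δ` and the real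
coefficients are mapped by `φ`. -/
def IsSolution {R : Type} [CommRing R] (φ : ℝ →+* R) (s : R) (Φ : S.SCM) (u : Stack S.mu → R)
    (x : Stack S.mx → R) (z : Stack S.mz → R) : Prop :=
  s • (S.stackE.map φ *ᵥ x) = S.stackAxx.map φ *ᵥ x + S.stackBxv.map φ *ᵥ (Φ.map φ *ᵥ z) +
      S.stackBxu.map φ *ᵥ u ∧
    z = S.stackCzx.map φ *ᵥ x + S.stackDzv.map φ *ᵥ (Φ.map φ *ᵥ z) + S.stackDzu.map φ *ᵥ u

/-- The output of the system in the operator domain. -/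
def output {R : Type} [CommRing R] (φ : ℝ →+* R) (Φ : S.SCM) (u : Stack S.mu → R)
    (x : Stack S.mx → R) (z : Stack S.mz → R) : Stack S.my → R :=
  S.stackCyx.map φ *ᵥ x + S.stackDyv.map φ *ᵥ (Φ.map φ *ᵥ z) + S.stackDyu.map φ *ᵥ u

variable {S}

/-- Polynomial solutions of the system equations give trajectories starting at `0`. -/
theorem IsSolution.isOutput {Φ : S.SCM} {u : Stack S.mu → ℝ[X]} {x : Stack S.mx → ℝ[X]}
    {z : Stack S.mz → ℝ[X]} (h : S.IsSolution C X Φ u x z) {K : ℕ}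
    (hK : ∀ i, (x i).natDegree < K) :
    S.IsOutput τ Φ 0 (τ.signalVec K u) (τ.signalVec K (S.output C Φ u x z)) := by
  rw [isOutput_iff]
  -- Only `x` is differentiated, so only its degree must stay below `K`. Truncating the other
  -- signals is harmless, as the remaining operations are linear with constant coefficients.
  refine ⟨τ.signalVec K x, τ.signalVec K fun i => X * x i, τ.signalVec K z,
    funext fun i => TimeKind.signal_start (hK i), TimeKind.isDelta_signalVec hK,
    fun t => ⟨?_, ?_, ?_⟩⟩
  · have h1 : (S.stackE.map C *ᵥ fun i => X * x i) = (X : ℝ[X]) • (S.stackE.map C *ᵥ x) :=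
      mulVec_smul (S.stackE.map C) (X : ℝ[X]) x
    rw [← TimeKind.signalVec_mulVec, h1, h.1]
    simp only [TimeKind.signalVec_add, TimeKind.signalVec_mulVec]
  · conv_lhs => rw [h.2]
    simp only [TimeKind.signalVec_add, TimeKind.signalVec_mulVec]
  · simp only [output, TimeKind.signalVec_add, TimeKind.signalVec_mulVec]

/-! ### Passage between rational and polynomial solutions -/

theorem map_mulVec_map {R R' : Type} [CommRing R] [CommRing R'] (φ : ℝ →+* R) (f : R →+* R')
    {m n : Type} [Fintype n] (M : Matrix m n ℝ) (w : n → R) :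
    (M.map (f.comp φ) *ᵥ fun j => f (w j)) = fun i => f ((M.map φ *ᵥ w) i) := by
  funext i
  simp [mulVec, dotProduct]

theorem map_output {R R' : Type} [CommRing R] [CommRing R'] (φ : ℝ →+* R) (f : R →+* R')
    (Φ : S.SCM) (u : Stack S.mu → R) (x : Stack S.mx → R) (z : Stack S.mz → R) :
    S.output (f.comp φ) Φ (fun i => f (u i)) (fun i => f (x i)) (fun i => f (z i)) =
      fun i => f (S.output φ Φ u x z i) := by
  simp only [output, map_mulVec_map]
  funext i
  simp

theorem isSolution_map_iff {R R' : Type} [CommRing R] [CommRing R'] (φ : ℝ →+* R) (f : R →+* R')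
    (hf : Function.Injective f) (s : R)
    (Φ : S.SCM) (u : Stack S.mu → R) (x : Stack S.mx → R) (z : Stack S.mz → R) :
    S.IsSolution (f.comp φ) (f s) Φ (fun i => f (u i)) (fun i => f (x i)) (fun i => f (z i)) ↔
      S.IsSolution φ s Φ u x z := by
  simp only [IsSolution, map_mulVec_map]
  simp only [funext_iff, Pi.add_apply, Pi.smul_apply, smul_eq_mul, ← map_mul, ← map_add,
    hf.eq_iff]

theorem IsSolution.smul {R : Type} [CommRing R] {φ : ℝ →+* R} {s : R} {Φ : S.SCM}
    {u : Stack S.mu → R} {x : Stack S.mx → R} {z : Stack S.mz → R} (c : R)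
    (h : S.IsSolution φ s Φ u x z) : S.IsSolution φ s Φ (c • u) (c • x) (c • z) := by
  refine ⟨?_, ?_⟩
  · simp only [mulVec_smul, ← smul_add]
    rw [smul_comm, h.1]
  · conv_lhs => rw [h.2]
    simp only [mulVec_smul, ← smul_add]

theorem output_smul {R : Type} [CommRing R] (φ : ℝ →+* R) (Φ : S.SCM)
    (u : Stack S.mu → R) (x : Stack S.mx → R) (z : Stack S.mz → R) (c : R) :
    S.output φ Φ (c • u) (c • x) (c • z) = c • S.output φ Φ u x z := by
  simp only [output, mulVec_smul, ← smul_add]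

theorem algebraMap_comp_C : (algebraMap ℝ[X] (RatFunc ℝ)).comp C = RatFunc.C := by
  ext r
  simp

/-- Rational solutions, of two systems for the same input, with different outputs: the systems
are differentiable from each other. -/
theorem differentiableSCM_of_isSolution {Φ Φ' : S.SCM} {u : Stack S.mu → RatFunc ℝ}
    {x x' : Stack S.mx → RatFunc ℝ} {z z' : Stack S.mz → RatFunc ℝ}
    (h : S.IsSolution RatFunc.C RatFunc.X Φ u x z)
    (h' : S.IsSolution RatFunc.C RatFunc.X Φ' u x' z')
    (hne : S.output RatFunc.C Φ u x z ≠ S.output RatFunc.C Φ' u x' z') :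
    S.DifferentiableSCM τ Φ Φ' := by
  rintro x₀ ⟨u₀, ⟨y₀, hy₀⟩, ⟨y₀', hy₀'⟩⟩
  -- If the given common input already separates the outputs it suffices; otherwise a separating
  -- trajectory from the zero state is added, leaving `x₀` unchanged.
  by_cases hyy : y₀ = y₀'
  swap
  · exact ⟨u₀, y₀, y₀', hy₀, hy₀', hyy⟩
  obtain ⟨p, g, hp, hg⟩ := exists_common_denominator
    (Sum.elim u (Sum.elim (Sum.elim x x') (Sum.elim z z')))
  set f := algebraMap ℝ[X] (RatFunc ℝ) with hf
  have finj : Function.Injective f := RatFunc.algebraMap_injective ℝ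
  let U : Stack S.mu → ℝ[X] := fun i => g (.inl i)
  let X₁ : Stack S.mx → ℝ[X] := fun i => g (.inr (.inl (.inl i)))
  let X₂ : Stack S.mx → ℝ[X] := fun i => g (.inr (.inl (.inr i)))
  let Z₁ : Stack S.mz → ℝ[X] := fun i => g (.inr (.inr (.inl i)))
  let Z₂ : Stack S.mz → ℝ[X] := fun i => g (.inr (.inr (.inr i)))
  have hU : (fun i => f (U i)) = f p • u := funext fun i => hg _
  have hX₁ : (fun i => f (X₁ i)) = f p • x := funext fun i => hg _
  have hX₂ : (fun i => f (X₂ i)) = f p • x' := funext fun i => hg _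
  have hZ₁ : (fun i => f (Z₁ i)) = f p • z := funext fun i => hg _
  have hZ₂ : (fun i => f (Z₂ i)) = f p • z' := funext fun i => hg _
  have h₁ : S.IsSolution C X Φ U X₁ Z₁ := by
    rw [← isSolution_map_iff C f finj, hU, hX₁, hZ₁, algebraMap_comp_C, hf, RatFunc.algebraMap_X]
    exact h.smul _
  have h₂ : S.IsSolution C X Φ' U X₂ Z₂ := by
    rw [← isSolution_map_iff C f finj, hU, hX₂, hZ₂, algebraMap_comp_C, hf, RatFunc.algebraMap_X]
    exact h'.smul _
  have hne' : S.output C Φ U X₁ Z₁ ≠ S.output C Φ' U X₂ Z₂ := by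
    intro heq
    apply hne
    have h3 := map_output C f Φ U X₁ Z₁
    have h4 := map_output C f Φ' U X₂ Z₂
    rw [heq, ← h4, hU, hX₁, hX₂, hZ₁, hZ₂, algebraMap_comp_C, output_smul, output_smul] at h3
    exact smul_right_injective _ ((map_ne_zero_iff f finj).2 hp) h3
  -- The first two bounds give zero initial states; the third keeps the output difference within the
  -- range where `signal` is injective.
  obtain ⟨K, hK₁, hK₂, hK₃⟩ : ∃ K, (∀ i, (X₁ i).natDegree < K) ∧ (∀ i, (X₂ i).natDegree < K) ∧
      ∀ i, (S.output C Φ U X₁ Z₁ i - S.output C Φ' U X₂ Z₂ i).natDegree < K := by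
    have bound : ∀ {ι : Type} [Finite ι] (q : ι → ℝ[X]), ∃ K, ∀ i, (q i).natDegree < K := by
      intro ι _ q
      obtain ⟨K, hK⟩ := (Set.finite_range fun i => (q i).natDegree).bddAbove
      exact ⟨K + 1, fun i => Nat.lt_succ_of_le (hK ⟨i, rfl⟩)⟩
    obtain ⟨K₁, h1⟩ := bound X₁
    obtain ⟨K₂, h2⟩ := bound X₂
    obtain ⟨K₃, h3⟩ := bound fun i => S.output C Φ U X₁ Z₁ i - S.output C Φ' U X₂ Z₂ i
    exact ⟨K₁ + K₂ + K₃, fun i => (h1 i).trans_le (by omega), fun i => (h2 i).trans_le (by omega),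
      fun i => (h3 i).trans_le (by omega)⟩
  have hout₁ := hy₀.add (h₁.isOutput (τ := τ) hK₁)
  have hout₂ := hy₀'.add (h₂.isOutput (τ := τ) hK₂)
  rw [add_zero] at hout₁ hout₂
  refine ⟨_, _, _, hout₁, hout₂, fun heq => hne' (funext fun i => ?_)⟩
  refine sub_eq_zero.1 (TimeKind.signal_injective (τ := τ) (hK₃ i).le ?_)
  rw [map_sub, sub_eq_zero]
  funext t
  have h3 := congrFun (congrFun heq t) i
  simpa [hyy, TimeKind.signalVec] using h3

/-! ## Transfer function matrices of the stacked system -/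

variable (S)

/-- `λ E - Axx` for the stacked system. -/
noncomputable abbrev statePencil : Matrix (Stack S.mx) (Stack S.mx) (RatFunc ℝ) :=
  (RatFunc.X : RatFunc ℝ) • constRat S.stackE - constRat S.stackAxx
/-- The transfer function matrix of the stacked system from `v` to `z`. -/
noncomputable abbrev stackGzv : Matrix (Stack S.mz) (Stack S.mv) (RatFunc ℝ) :=
  transferMatrix S.stackE S.stackAxx S.stackBxv S.stackCzx S.stackDzv
/-- The transfer function matrix of the stacked system from `u` to `z`. -/
noncomputable abbrev stackGzu : Matrix (Stack S.mz) (Stack S.mu) (RatFunc ℝ) :=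
  transferMatrix S.stackE S.stackAxx S.stackBxu S.stackCzx S.stackDzu
/-- The transfer function matrix of the stacked system from `v` to `y`. -/
noncomputable abbrev stackGyv : Matrix (Stack S.my) (Stack S.mv) (RatFunc ℝ) :=
  transferMatrix S.stackE S.stackAxx S.stackBxv S.stackCyx S.stackDyv
/-- The transfer function matrix of the stacked system from `u` to `y`. -/
noncomputable abbrev stackGyu : Matrix (Stack S.my) (Stack S.mu) (RatFunc ℝ) :=
  transferMatrix S.stackE S.stackAxx S.stackBxu S.stackCyx S.stackDyu

variable {S}

theorem transferMatrix_mulVec {n p q : Type} [Fintype n] [DecidableEq n] [Fintype q]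
    (E A : Matrix n n ℝ) (B : Matrix n q ℝ) (C : Matrix p n ℝ) (D : Matrix p q ℝ)
    (w : q → RatFunc ℝ) :
    transferMatrix E A B C D *ᵥ w = constRat D *ᵥ w + constRat C *ᵥ
      (((RatFunc.X : RatFunc ℝ) • constRat E - constRat A)⁻¹ *ᵥ (constRat B *ᵥ w)) := by
  simp only [transferMatrix, add_mulVec, mulVec_mulVec, Matrix.mul_assoc]

/-- The system equations in terms of transfer function matrices. -/
theorem isSolution_iff (hP : IsUnit S.statePencil.det) (Φ : S.SCM) (u : Stack S.mu → RatFunc ℝ)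
    (x : Stack S.mx → RatFunc ℝ) (z : Stack S.mz → RatFunc ℝ) :
    S.IsSolution RatFunc.C RatFunc.X Φ u x z ↔
      x = S.statePencil⁻¹ *ᵥ (constRat S.stackBxv *ᵥ (constRat Φ *ᵥ z) +
        constRat S.stackBxu *ᵥ u) ∧
      z = S.stackGzv *ᵥ (constRat Φ *ᵥ z) + S.stackGzu *ᵥ u := by
  have h1 : (RatFunc.X : RatFunc ℝ) • (S.stackE.map RatFunc.C *ᵥ x) = S.stackAxx.map RatFunc.C *ᵥ x +
      S.stackBxv.map RatFunc.C *ᵥ (Φ.map RatFunc.C *ᵥ z) + S.stackBxu.map RatFunc.C *ᵥ u ↔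
      x = S.statePencil⁻¹ *ᵥ (constRat S.stackBxv *ᵥ (constRat Φ *ᵥ z) +
        constRat S.stackBxu *ᵥ u) := by
    have h2 : S.statePencil *ᵥ x = (RatFunc.X : RatFunc ℝ) • (S.stackE.map RatFunc.C *ᵥ x) -
        S.stackAxx.map RatFunc.C *ᵥ x := by
      simp only [sub_mulVec, smul_mulVec]
      rfl
    rw [add_assoc, ← sub_eq_iff_eq_add', ← h2]
    constructor
    · intro h
      change _ = constRat S.stackBxv *ᵥ (constRat Φ *ᵥ z) + constRat S.stackBxu *ᵥ u at h
      rw [← h, mulVec_mulVec, nonsing_inv_mul _ hP, one_mulVec]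
    · intro h
      rw [h, mulVec_mulVec, mul_nonsing_inv _ hP, one_mulVec]
      rfl
  unfold IsSolution
  rw [h1]
  refine and_congr_right fun hx => ?_
  rw [transferMatrix_mulVec, transferMatrix_mulVec]
  conv_lhs => rw [hx]
  simp only [mulVec_add]
  refine Eq.congr rfl ?_
  simp only [constRat, statePencil]
  abel

theorem IsSolution.output_eq (hP : IsUnit S.statePencil.det) {Φ : S.SCM}
    {u : Stack S.mu → RatFunc ℝ} {x : Stack S.mx → RatFunc ℝ} {z : Stack S.mz → RatFunc ℝ}
    (h : S.IsSolution RatFunc.C RatFunc.X Φ u x z) :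
    S.output RatFunc.C Φ u x z = S.stackGyv *ᵥ (constRat Φ *ᵥ z) + S.stackGyu *ᵥ u := by
  rw [isSolution_iff hP] at h
  rw [transferMatrix_mulVec, transferMatrix_mulVec, output, h.1]
  simp only [mulVec_add, constRat, statePencil]
  abel

/-! ## The network pencil -/

variable (S)

/-- The matrix that multiplies `δ(x, z)` in the descriptor form with state `(x, z)`. -/
abbrev networkE : Matrix (Stack S.mx ⊕ Stack S.mz) (Stack S.mx ⊕ Stack S.mz) ℝ :=
  fromBlocks S.stackE 0 0 0

/-- The system matrix of the descriptor form with state `(x, z)`. -/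
abbrev networkA (Φ : S.SCM) : Matrix (Stack S.mx ⊕ Stack S.mz) (Stack S.mx ⊕ Stack S.mz) ℝ :=
  fromBlocks S.stackAxx (S.stackBxv * Φ) S.stackCzx (S.stackDzv * Φ - 1)

variable {S}

theorem networkPencil_mulVec (Φ : S.SCM) (x : Stack S.mx → RatFunc ℝ)
    (z : Stack S.mz → RatFunc ℝ) :
    polyRat (polyPencil S.networkE (S.networkA Φ)) *ᵥ Sum.elim x z =
      Sum.elim (S.statePencil *ᵥ x - constRat S.stackBxv *ᵥ (constRat Φ *ᵥ z))
        (z - (constRat S.stackCzx *ᵥ x + constRat S.stackDzv *ᵥ (constRat Φ *ᵥ z))) := by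
  have h1 : constRat (S.networkA Φ) = fromBlocks (constRat S.stackAxx)
      (constRat S.stackBxv * constRat Φ) (constRat S.stackCzx)
      (constRat S.stackDzv * constRat Φ - 1) := by
    rw [← constRat_mul, ← constRat_mul]
    simp only [constRat, networkA, fromBlocks_map]
    congr 1
    rw [Matrix.map_sub _ (map_sub _), Matrix.map_one _ (map_zero _) (map_one _)]
  have h2 : constRat S.networkE = fromBlocks (constRat S.stackE) 0 0 0 := by
    simp only [constRat, networkE, fromBlocks_map, Matrix.map_zero _ (map_zero _)]
  rw [polyRat_polyPencil, h1, h2, sub_mulVec, smul_mulVec, fromBlocks_mulVec, fromBlocks_mulVec]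
  funext i
  rcases i with i | i
  · simp [sub_mulVec, smul_mulVec, mulVec_mulVec]
    ring
  · simp [sub_mulVec, mulVec_mulVec]
    ring

/-- Regularity makes the pencil in `(x, z)` invertible over the rational functions, so every
rational input has a response. -/
theorem exists_isSolution {Φ : S.SCM} (h : S.NetworkRegular Φ) (u : Stack S.mu → RatFunc ℝ) :
    ∃ x z, S.IsSolution RatFunc.C RatFunc.X Φ u x z := by
  have hdet : IsUnit (polyRat (polyPencil S.networkE (S.networkA Φ))).det :=
    isUnit_det_polyRat h.det_polyPencil_ne_zero
  let ξ := (polyRat (polyPencil S.networkE (S.networkA Φ)))⁻¹ *ᵥ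
    Sum.elim (constRat S.stackBxu *ᵥ u) (constRat S.stackDzu *ᵥ u)
  have hξ : polyRat (polyPencil S.networkE (S.networkA Φ)) *ᵥ ξ =
      Sum.elim (constRat S.stackBxu *ᵥ u) (constRat S.stackDzu *ᵥ u) := by
    rw [mulVec_mulVec, mul_nonsing_inv _ hdet, one_mulVec]
  rw [← Sum.elim_comp_inl_inr ξ, networkPencil_mulVec, Sum.elim_eq_iff] at hξ
  refine ⟨ξ ∘ Sum.inl, ξ ∘ Sum.inr, ?_, ?_⟩
  · have h1 := hξ.1
    rw [sub_mulVec, smul_mulVec, sub_eq_iff_eq_add, sub_eq_iff_eq_add] at h1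
    refine h1.trans ?_
    simp only [constRat]
    abel
  · have h1 := hξ.2
    rw [sub_eq_iff_eq_add] at h1
    refine h1.trans ?_
    simp only [constRat]
    abel

end NDS

/-! ### Null space of `G_yv` and column space of the pencil -/

namespace NDS

variable {N : ℕ} {S : NDS N} {τ : TimeKind}

theorem stackGzu_exists_mulVec_eq (hsub : ∀ i, S.SubsystemRegular i)
    (hzu : ∀ i, IsFNRR (S.Gzu i)) (b : Stack S.mz → RatFunc ℝ) :
    ∃ a, S.stackGzu *ᵥ a = b := by
  choose a ha using fun i => (hzu i).exists_mulVec_eq fun j => b ⟨i, j⟩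
  refine ⟨fun k => a k.1 k.2, ?_⟩
  rw [stackGzu, transferMatrix_blockDiagonal' _ _ _ hsub]
  funext ⟨i, j⟩
  rw [blockDiagonal'_mulVec_apply]
  exact congrFun (ha i) j

namespace Factorization

variable (F : S.Factorization)

/-- The block diagonal matrix whose columns span the null space of the stacked `G_yv`. -/
noncomputable def nullBasis : Matrix (Stack S.mv) F.NullIndex (RatFunc ℝ) :=
  blockDiagonal' fun i => polyRat (F.smith i).Vinv2ᵀ

theorem stackGyv_mulVec_eq_zero_iff (hsub : ∀ i, S.SubsystemRegular i)
    (ω : Stack S.mv → RatFunc ℝ) :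
    S.stackGyv *ᵥ ω = 0 ↔ ∃ b, ω = F.nullBasis *ᵥ b := by
  have h1 : S.stackGyv *ᵥ ω = 0 ↔ ∀ i, S.Gyv i *ᵥ (fun j => ω ⟨i, j⟩) = 0 := by
    rw [stackGyv, transferMatrix_blockDiagonal' _ _ _ hsub]
    simp only [funext_iff, Sigma.forall, blockDiagonal'_mulVec_apply]
    rfl
  rw [h1]
  simp only [(F.smith _).mulVec_eq_zero_iff]
  constructor
  · intro h
    choose b hb using h
    refine ⟨fun k => b k.1 k.2, ?_⟩
    funext ⟨i, j⟩
    rw [nullBasis, blockDiagonal'_mulVec_apply]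
    exact congrFun (hb i) j
  · rintro ⟨b, rfl⟩ i
    refine ⟨fun k => b ⟨i, k⟩, ?_⟩
    funext j
    rw [nullBasis, blockDiagonal'_mulVec_apply]

/-- Multiply the decomposition `D⁻¹ V₂ᵀ = R + Q Ω⁻¹` by `D` on the left and by `Ω` on the right. -/
theorem nullBasis_mul_block (i : Fin N) :
    polyRat (F.smith i).Vinv2ᵀ * polyRat (F.Ω i) =
      polyRat (F.DD i * (F.R i * F.Ω i + F.Q i)) := by
  have hD := isUnit_det_polyRat (F.DD_det i)
  have hΩ := isUnit_det_polyRat (F.Ω_det i)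
  have h1 : polyRat (F.smith i).Vinv2ᵀ = polyRat (F.DD i) *
      (polyRat (F.R i) + polyRat (F.Q i) * (polyRat (F.Ω i))⁻¹) := by
    rw [← F.RQΩ_eq i, mul_nonsing_inv_cancel_left _ _ hD]
  rw [h1, Matrix.mul_assoc, Matrix.add_mul, nonsing_inv_mul_cancel_right _ _ hΩ, polyRat_mul,
    polyRat_add, polyRat_mul]

theorem polyRat_Xhat :
    polyRat F.Xhat = F.nullBasis * blockDiagonal' fun i => polyRat (F.Ω i) := by
  rw [Xhat, polyRat_blockDiagonal', nullBasis, ← blockDiagonal'_mul]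
  simp only [nullBasis_mul_block]

theorem polyRat_Yhat (hsub : ∀ i, S.SubsystemRegular i) :
    polyRat F.Yhat = S.stackGzv * polyRat F.Xhat := by
  rw [stackGzv, transferMatrix_blockDiagonal' _ _ _ hsub, Xhat, Yhat, polyRat_blockDiagonal',
    polyRat_blockDiagonal', ← blockDiagonal'_mul]
  congr 1
  funext i
  have hG : transferMatrix (S.E i) (S.Axx i) (S.Bxv i) (S.Czx i) (S.Dzv i) =
      polyRat (F.NN i) * (polyRat (F.DD i))⁻¹ := F.Gzv_eq i
  rw [hG, polyRat_mul, polyRat_mul, Matrix.mul_assoc,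
    nonsing_inv_mul_cancel_left _ _ (isUnit_det_polyRat (F.DD_det i))]

/-- The column space of `Xhat - Φ₀ Yhat` is the image of the null space of `G_yv` under
`1 - Φ₀ G_zv`. -/
theorem exists_pencil_mulVec_eq_iff (hsub : ∀ i, S.SubsystemRegular i) (Φ₀ : S.SCM)
    (w : Stack S.mv → RatFunc ℝ) :
    (∃ a, polyRat (F.pencil Φ₀) *ᵥ a = w) ↔
      ∃ ω, S.stackGyv *ᵥ ω = 0 ∧ w = ω - constRat Φ₀ *ᵥ (S.stackGzv *ᵥ ω) := by
  have hpencil : ∀ a, polyRat (F.pencil Φ₀) *ᵥ a =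
      polyRat F.Xhat *ᵥ a - constRat Φ₀ *ᵥ (S.stackGzv *ᵥ (polyRat F.Xhat *ᵥ a)) := by
    intro a
    rw [pencil, polyRat_sub, polyRat_mul, polyRat_map_C, F.polyRat_Yhat hsub, sub_mulVec,
      mulVec_mulVec, mulVec_mulVec, Matrix.mul_assoc]
  constructor
  · rintro ⟨a, rfl⟩
    refine ⟨polyRat F.Xhat *ᵥ a, ?_, hpencil a⟩
    rw [F.stackGyv_mulVec_eq_zero_iff hsub, polyRat_Xhat]
    exact ⟨_, (mulVec_mulVec _ _ _).symm⟩
  · rintro ⟨ω, hω, rfl⟩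
    obtain ⟨b, rfl⟩ := (F.stackGyv_mulVec_eq_zero_iff hsub ω).1 hω
    -- Since the `Ω i` are invertible over the rational functions, `Xhat` has the same column space
    -- as `nullBasis`.
    refine ⟨blockDiagonal' (fun i => (polyRat (F.Ω i))⁻¹) *ᵥ b, ?_⟩
    have : polyRat F.Xhat *ᵥ (blockDiagonal' (fun i => (polyRat (F.Ω i))⁻¹) *ᵥ b) =
        F.nullBasis *ᵥ b := by
      rw [polyRat_Xhat, mulVec_mulVec, Matrix.mul_assoc,
        blockDiagonal'_mul_inv fun i => isUnit_det_polyRat (F.Ω_det i), Matrix.mul_one]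
    rw [hpencil, this]

end Factorization

/-! ## The two implications -/

theorem globallyIdentifiableAt_of_forall {Φ₀ : S.SCM} (hsub : ∀ i, S.SubsystemRegular i)
    (hnet : S.NetworkRegular Φ₀) (hzu : ∀ i, IsFNRR (S.Gzu i))
    (h : ∀ (w : Stack S.mv → ℝ) (ω : Stack S.mv → RatFunc ℝ), S.stackGyv *ᵥ ω = 0 →
      (fun j => RatFunc.C (w j)) = ω - constRat Φ₀ *ᵥ (S.stackGzv *ᵥ ω) → w = 0) :
    S.GloballyIdentifiableAt τ Φ₀ := by
  intro Φ _ hΦ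
  have hP : IsUnit S.statePencil.det := isUnit_det_blockDiagonal'_pencil hsub
  obtain ⟨j, hj⟩ : ∃ j, (fun i => Φ i j - Φ₀ i j) ≠ 0 := by
    by_contra! hall
    exact hΦ (Matrix.ext fun i j => sub_eq_zero.1 (congrFun (hall j) i))
  -- A constant internal output selecting a column in which `Φ` and `Φ₀` differ; the input is then
  -- solved for.
  let z' : Stack S.mz → RatFunc ℝ := Pi.single j 1
  obtain ⟨u, hu⟩ := stackGzu_exists_mulVec_eq hsub hzu (z' - S.stackGzv *ᵥ (constRat Φ *ᵥ z'))
  have h' := (isSolution_iff hP Φ u _ z').2 ⟨rfl, by rw [hu]; abel⟩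
  obtain ⟨x, z, h₀⟩ := exists_isSolution hnet u
  refine differentiableSCM_of_isSolution h₀ h' fun heq => hj ?_
  rw [h₀.output_eq hP, h'.output_eq hP, add_left_inj] at heq
  -- Equal outputs for the same input put the difference of the two `v` signals into the null space
  -- of `G_yv`, and `G_zv` maps it to `z' - z`. The terms in `z` cancel, leaving the constant `(Φ -
  -- Φ₀) e_j`.
  refine h _ (constRat Φ *ᵥ z' - constRat Φ₀ *ᵥ z) ?_ ?_
  · rw [mulVec_sub, heq, sub_self]
  · have hz := ((isSolution_iff hP Φ₀ u x z).1 h₀).2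
    have hz' : S.stackGzv *ᵥ (constRat Φ *ᵥ z' - constRat Φ₀ *ᵥ z) = z' - z := by
      rw [mulVec_sub, eq_sub_of_add_eq hz.symm, hu]
      abel
    rw [hz', mulVec_sub]
    funext i
    simp [z', constRat]

/-- Zero transfer function, in terms of polynomial vectors, of the system that is driven by a
scalar input entering through `v = Φ₀ z + w g`. -/
theorem exists_polynomial_certificate {Φ₀ : S.SCM} (hsub : ∀ i, S.SubsystemRegular i)
    (hnet : S.NetworkRegular Φ₀) (w : Stack S.mv → ℝ) (ω : Stack S.mv → RatFunc ℝ)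
    (hω : S.stackGyv *ᵥ ω = 0)
    (hw : (fun j => RatFunc.C (w j)) = ω - constRat Φ₀ *ᵥ (S.stackGzv *ᵥ ω)) (l : Stack S.my) :
    ∃ (p : ℝ[X]) (q : Stack S.mx ⊕ Stack S.mz → ℝ[X]), p ≠ 0 ∧
      (q ᵥ* ((X : ℝ[X]) • S.networkE.map C - (S.networkA Φ₀).map C) =
        fun j => p * C (Sum.elim (S.stackCyx l) ((S.stackDyv * Φ₀) l) j)) ∧
      q ⬝ᵥ (fun i => C (Sum.elim (S.stackBxv *ᵥ w) (S.stackDzv *ᵥ w) i)) =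
        - (p * C ((S.stackDyv *ᵥ w) l)) := by
  have hP : IsUnit S.statePencil.det := isUnit_det_blockDiagonal'_pencil hsub
  let P := polyPencil S.networkE (S.networkA Φ₀)
  let c : Stack S.mx ⊕ Stack S.mz → ℝ[X] :=
    fun j => C (Sum.elim (S.stackCyx l) ((S.stackDyv * Φ₀) l) j)
  -- Cramer's rule: `p = det P` and `q = c adj P` clear the denominators of `c P⁻¹`.
  have hcP : (c ᵥ* P.adjugate) ᵥ* P = P.det • c := by
    rw [vecMul_vecMul, adjugate_mul, vecMul_smul, vecMul_one]
  refine ⟨P.det, c ᵥ* P.adjugate, hnet.det_polyPencil_ne_zero, hcP, ?_⟩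
  set f := algebraMap ℝ[X] (RatFunc ℝ) with hf
  have finj : Function.Injective f := RatFunc.algebraMap_injective ℝ
  have hfC : ∀ r, f (C r) = RatFunc.C r := fun r => RatFunc.algebraMap_C r
  let z := S.stackGzv *ᵥ ω
  let x := S.statePencil⁻¹ *ᵥ (constRat S.stackBxv *ᵥ ω)
  let wr : Stack S.mv → RatFunc ℝ := fun j => RatFunc.C (w j)
  have hwr : wr = ω - constRat Φ₀ *ᵥ z := hw
  have hmap : ∀ {m : Fin N → ℕ} (M : Matrix (Stack m) (Stack S.mv) ℝ) (i : Stack m),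
      f (C ((M *ᵥ w) i)) = (constRat M *ᵥ wr) i := by
    intro m M i
    rw [hfC]
    exact RingHom.map_mulVec RatFunc.C M w i
  -- With `x = (λE - A)⁻¹ B_xv ω` and `z = G_zv ω`, the relation `ω = Φ₀ z + w` says that `(x, z)`
  -- is the response to a unit input through `w`.
  have hξ : polyRat P *ᵥ Sum.elim x z =
      fun i => f (C (Sum.elim (S.stackBxv *ᵥ w) (S.stackDzv *ᵥ w) i)) := by
    rw [networkPencil_mulVec]
    funext i
    rcases i with i | i
    · rw [Sum.elim_inl, Sum.elim_inl, hmap, hwr, mulVec_sub]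
      simp only [x]
      rw [mulVec_mulVec _ S.statePencil, mul_nonsing_inv _ hP, one_mulVec]
    · rw [Sum.elim_inr, Sum.elim_inr, hmap, hwr, mulVec_sub]
      have hz : z = constRat S.stackDzv *ᵥ ω + constRat S.stackCzx *ᵥ x :=
        transferMatrix_mulVec _ _ _ _ _ _
      nth_rewrite 1 [hz]
      simp only [Pi.sub_apply, Pi.add_apply]
      ring
  -- The output of that response is `G_yv ω = 0`; splitting `ω = Φ₀ z + w` isolates the feedthrough
  -- `D_yv w`.
  have hy : (fun j => f (c j)) ⬝ᵥ Sum.elim x z = - f (C ((S.stackDyv *ᵥ w) l)) := by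
    have h1 : (fun j => f (c j)) ⬝ᵥ Sum.elim x z =
        (constRat S.stackCyx *ᵥ x) l + (constRat S.stackDyv *ᵥ (constRat Φ₀ *ᵥ z)) l := by
      rw [mulVec_mulVec z, ← constRat_mul]
      simp only [dotProduct, Fintype.sum_sum_type, c, hfC, Sum.elim_inl, Sum.elim_inr]
      rfl
    have h2 := congrFun (transferMatrix_mulVec S.stackE S.stackAxx S.stackBxv S.stackCyx S.stackDyv
      ω) l
    rw [hω, Pi.zero_apply, Pi.add_apply] at h2
    change 0 = _ + (constRat S.stackCyx *ᵥ x) l at h2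
    rw [h1, hmap, hwr, mulVec_sub, Pi.sub_apply]
    linear_combination -h2
  apply finj
  have h3 : ∀ v v' : Stack S.mx ⊕ Stack S.mz → ℝ[X],
      f (v ⬝ᵥ v') = (fun i => f (v i)) ⬝ᵥ fun i => f (v' i) := by
    intro v v'
    simp [dotProduct]
  have h4 : (fun j => f ((c ᵥ* P.adjugate) j)) ᵥ* polyRat P = f P.det • fun j => f (c j) := by
    funext j
    have := congrArg f (congrFun hcP j)
    rw [Pi.smul_apply, smul_eq_mul, map_mul] at this
    rw [Pi.smul_apply, smul_eq_mul, ← this]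
    exact (RingHom.map_vecMul f P (c ᵥ* P.adjugate) j).symm
  rw [h3, ← hξ, dotProduct_mulVec, h4, smul_dotProduct, hy, map_neg, map_mul, smul_eq_mul,
    mul_neg]

/-- The rank one change of `Φ₀` acts as a scalar input `ε z'_j` entering through `w`, so the
difference of two trajectories is a zero-state response with zero transfer function. -/
theorem output_eq_of_certificate {Φ₀ Φ : S.SCM} {ε : ℝ} {w : Stack S.mv → ℝ} {j : Stack S.mz}
    (hΦ : ∀ z, Φ *ᵥ z = Φ₀ *ᵥ z + (ε * z j) • w)
    (hcert : ∀ l : Stack S.my, ∃ (p : ℝ[X]) (q : Stack S.mx ⊕ Stack S.mz → ℝ[X]), p ≠ 0 ∧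
      (q ᵥ* ((X : ℝ[X]) • S.networkE.map C - (S.networkA Φ₀).map C) =
        fun j => p * C (Sum.elim (S.stackCyx l) ((S.stackDyv * Φ₀) l) j)) ∧
      q ⬝ᵥ (fun i => C (Sum.elim (S.stackBxv *ᵥ w) (S.stackDzv *ᵥ w) i)) =
        - (p * C ((S.stackDyv *ᵥ w) l)))
    {x₀ : Stack S.mx → ℝ} {u : τ.Time → Stack S.mu → ℝ} {y y' : τ.Time → Stack S.my → ℝ}
    (hy : S.IsOutput τ Φ₀ x₀ u y) (hy' : S.IsOutput τ Φ x₀ u y') : y = y' := by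
  rw [isOutput_iff] at hy hy'
  obtain ⟨x, dx, z, h0, hδ, h⟩ := hy
  obtain ⟨x', dx', z', h0', hδ', h'⟩ := hy'
  funext t l
  obtain ⟨p, q, hp, hq, hqb⟩ := hcert l
  have hE : ∀ t, S.networkE *ᵥ Sum.elim (x' t - x t) (z' t - z t) =
      Sum.elim (S.stackE *ᵥ (x' t - x t)) 0 := by
    intro t
    simp [fromBlocks_mulVec]
  have key := TimeKind.output_eq_zero (τ := τ) S.networkE (S.networkA Φ₀)
    (Sum.elim (S.stackBxv *ᵥ w) (S.stackDzv *ᵥ w))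
    (Sum.elim (S.stackCyx l) ((S.stackDyv * Φ₀) l)) ((S.stackDyv *ᵥ w) l) p hp q hq hqb
    -- The `z` part is annihilated by `networkE`, so no differentiability of `z` or `z'` is needed.
    (fun t => Sum.elim (x' t - x t) (z' t - z t))
    (fun t => Sum.elim (S.stackE *ᵥ (dx' t - dx t)) 0) (fun t => ε * z' t j)
    (by rw [hE, h0, h0', sub_self, mulVec_zero]; exact Sum.elim_zero_zero)
    (by
      simp only [hE]
      rw [TimeKind.isDelta_iff]
      rintro (i | i)
      · exact (TimeKind.isDelta_iff _ _ _).1 ((hδ'.sub hδ).mulVec S.stackE) i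
      · exact TimeKind.IsScalarDelta.zero)
    (fun t => by
      rw [fromBlocks_mulVec]
      funext i
      rcases i with i | i
      · have h1 := congrFun (h t).1 i
        have h2 := congrFun (h' t).1 i
        rw [hΦ] at h2
        simp only [mulVec_sub, mulVec_add, mulVec_smul, Pi.add_apply, Pi.sub_apply, Pi.smul_apply,
          Sum.elim_inl, Sum.elim_comp_inl, Sum.elim_comp_inr, smul_eq_mul,
          ← mulVec_mulVec] at h1 h2 ⊢
        rw [h1, h2]
        ring
      · have h1 := congrFun (h t).2.1 i
        have h2 := congrFun (h' t).2.1 i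
        rw [hΦ] at h2
        simp only [mulVec_sub, mulVec_add, mulVec_smul, Pi.add_apply, Pi.sub_apply, Pi.smul_apply,
          Sum.elim_inr, Sum.elim_comp_inl, Sum.elim_comp_inr, smul_eq_mul, sub_mulVec, one_mulVec,
          Pi.zero_apply, ← mulVec_mulVec] at h1 h2 ⊢
        linarith) t
  have h1 := congrFun (h t).2.2 l
  have h2 := congrFun (h' t).2.2 l
  rw [hΦ] at h2
  have h3 : Sum.elim (S.stackCyx l) ((S.stackDyv * Φ₀) l) ⬝ᵥ Sum.elim (x' t - x t) (z' t - z t) =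
      (S.stackCyx *ᵥ (x' t - x t)) l + (S.stackDyv *ᵥ (Φ₀ *ᵥ (z' t - z t))) l := by
    rw [mulVec_mulVec]
    simp only [dotProduct, Fintype.sum_sum_type, Sum.elim_inl, Sum.elim_inr]
    rfl
  rw [h3] at key
  simp only [mulVec_sub, mulVec_add, mulVec_smul, Pi.add_apply, Pi.sub_apply, Pi.smul_apply,
    smul_eq_mul] at h1 h2 key
  linarith

/-- Regularity of the network is an open condition along lines of connection matrices. -/
theorem NetworkRegular.exists_ne_zero {Φ₀ : S.SCM} (h : S.NetworkRegular Φ₀) (Δ : S.SCM) :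
    ∃ ε : ℝ, ε ≠ 0 ∧ S.NetworkRegular (Φ₀ + ε • Δ) := by
  obtain ⟨s, hs⟩ := h
  let D : ℝ → ℂ := fun ε => (s • S.networkE.map (algebraMap ℝ ℂ) -
    (S.networkA (Φ₀ + ε • Δ)).map (algebraMap ℝ ℂ)).det
  have hline : Continuous fun ε : ℝ => Φ₀ + ε • Δ :=
    continuous_const.add (continuous_id.smul continuous_const)
  have hA : Continuous fun ε : ℝ => S.networkA (Φ₀ + ε • Δ) := by
    refine Continuous.matrix_fromBlocks continuous_const ?_ continuous_const ?_
    · exact continuous_const.matrix_mul hline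
    · exact (continuous_const.matrix_mul hline).sub continuous_const
  have hcont : Continuous D :=
    (continuous_const.sub (hA.matrix_map Complex.continuous_ofReal)).matrix_det
  have hD0 : D 0 ≠ 0 := by
    simp only [D, zero_smul, add_zero]
    exact hs
  have hev : ∀ᶠ ε in nhds (0 : ℝ), D ε ≠ 0 := hcont.continuousAt.eventually_ne hD0
  obtain ⟨ε, hε, hne⟩ := ((hev.filter_mono nhdsWithin_le_nhds).and
    (self_mem_nhdsWithin (a := (0 : ℝ)) (s := {0}ᶜ))).exists
  exact ⟨ε, hne, s, hε⟩

/-- A nonzero `w` would make a regular rank one perturbation of `Φ₀` in direction `w e_jᵀ`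
indistinguishable from `Φ₀`. The index `j` is arbitrary, but one must exist. -/
theorem eq_zero_of_globallyIdentifiableAt {Φ₀ : S.SCM} (hsub : ∀ i, S.SubsystemRegular i)
    (hnet : S.NetworkRegular Φ₀) (j : Stack S.mz) (hid : S.GloballyIdentifiableAt τ Φ₀)
    (w : Stack S.mv → ℝ) (ω : Stack S.mv → RatFunc ℝ) (hω : S.stackGyv *ᵥ ω = 0)
    (hw : (fun j => RatFunc.C (w j)) = ω - constRat Φ₀ *ᵥ (S.stackGzv *ᵥ ω)) : w = 0 := by
  by_contra hw0
  let Δ : S.SCM := vecMulVec w (Pi.single j 1)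
  obtain ⟨ε, hε, hreg⟩ := hnet.exists_ne_zero Δ
  have hΦ : ∀ z, (Φ₀ + ε • Δ) *ᵥ z = Φ₀ *ᵥ z + (ε * z j) • w := by
    intro z
    rw [add_mulVec, smul_mulVec, vecMulVec_mulVec]
    simp [smul_smul]
  have hne : Φ₀ + ε • Δ ≠ Φ₀ := by
    intro heq
    apply hw0
    have h1 := hΦ (Pi.single j 1)
    rw [heq, left_eq_add, Pi.single_eq_same, mul_one] at h1
    exact (smul_eq_zero.1 h1).resolve_left hε
  -- The zero trajectory makes the zero initial state admissible for both systems, so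
  -- differentiability is not vacuous there.
  obtain ⟨u, y, y', hy, hy', hyy⟩ := hid _ hreg hne 0
    ⟨fun _ => 0, ⟨_, isOutput_zero Φ₀⟩, ⟨_, isOutput_zero _⟩⟩
  exact hyy (output_eq_of_certificate hΦ
    (exists_polynomial_certificate hsub hnet w ω hω hw) hy hy')

end NDS

/-! ### The rank criterion -/

theorem corollary1 {N : ℕ} (S : NDS N) (τ : TimeKind) (Φ₀ : S.SCM)
    (hz : 0 < ∑ i, S.mz i)
    (hsub : ∀ i, S.SubsystemRegular i) (hnet : S.NetworkRegular Φ₀)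
    (hzu : ∀ i, IsFNRR (S.Gzu i)) (hyv : ∃ j, ¬ IsFNCR (S.Gyv j))
    (F : S.Factorization)
    (W : SmithForm (∑ i, S.mv i) (∑ i, F.nullDim i) (F.pencil Φ₀)) :
    S.GloballyIdentifiableAt τ Φ₀ ↔ IsFCR (stackedCoeffs W.Uinv2) := by
  have key : ∀ w : Stack S.mv → ℝ, stackedCoeffs W.Uinv2 *ᵥ w = 0 ↔
      ∃ ω, S.stackGyv *ᵥ ω = 0 ∧
        (fun j => RatFunc.C (w j)) = ω - constRat Φ₀ *ᵥ (S.stackGzv *ᵥ ω) := by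
    intro w
    rw [← F.exists_pencil_mulVec_eq_iff hsub, W.toRatFunc.exists_mulVec_eq_iff,
      stackedCoeffs_mulVec_eq_zero_iff]
    have h1 : (polyRat W.Uinv2 *ᵥ fun j => RatFunc.C (w j)) =
        fun i => algebraMap ℝ[X] (RatFunc ℝ) ((W.Uinv2 *ᵥ fun j => C (w j)) i) := by
      rw [← polyRat_mulVec]
      simp only [RatFunc.algebraMap_C]
    change W.Uinv2 *ᵥ (fun j => C (w j)) = 0 ↔ polyRat W.Uinv2 *ᵥ (fun j => RatFunc.C (w j)) = 0
    rw [h1, funext_iff, funext_iff]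
    exact forall_congr' fun i =>
      (map_eq_zero_iff _ (RatFunc.algebraMap_injective ℝ)).symm
  rw [isFCR_iff]
  constructor
  · intro hid w hw
    -- Since `m_z ≥ 1`, some component of `z` is available to drive the perturbation.
    obtain ⟨i, -, hi⟩ := Finset.exists_ne_zero_of_sum_ne_zero hz.ne'
    obtain ⟨ω, hω, hwω⟩ := (key w).1 hw
    exact NDS.eq_zero_of_globallyIdentifiableAt hsub hnet ⟨i, ⟨0, Nat.pos_of_ne_zero hi⟩⟩ hid w ω
      hω hwω
  · intro h
    exact NDS.globallyIdentifiableAt_of_forall hsub hnet hzu fun w ω hω hw =>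
      h w ((key w).2 ⟨ω, hω, hw⟩)
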